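/- **Model.** There are $n$ bidders (advertisers) and $k$ identical ad slots. In each round bidder $i$ has a value $v_i\ge 0$, drawn independently (across bidders and rounds) from a distribution with CDF $F_i$, density $f_i$ and finite mean. The virtual value is $\phi_i(x)=x-\frac{1-F_i(x)}{f_i(x)}$, read as $-\infty$ where $f_i(x)=0$ and $F_i(x)<1$ (in particular below the support), and as $x$ where $F_i(x)=1$; the distribution is regular if $\phi_i$ is non-decreasing on $[0,\infty)$. A mechanism assigns to every bid profile $v\in\mathbb R_{\ge0}^n$ a probability distribution $(x_W(v))_W$ over the sets $W\subseteq[n]$ of winners with $|W|\le k$ and expected payments $p_i(v)\ge 0$, measurably in $v$. It is incentive compatible (IC) if truthful bidding is a dominant strategy and gives nonnegative utility, where bidder $i$ with value $v_i$ has utility $v_i\sum_{W\ni i}x_W(b)-p_i(b)$ on bids $b$. The state of the user is a click-through rate $\mathrm{ctr}\in[0,1]$. If the set $W$ of ads is shown in state $\mathrm{ctr}$, the next state has law $P_W(\cdot\mid\mathrm{ctr})$, a Markov kernel on $[0,1]$. Using the IC mechanism $a=(x,p)$ in state $\mathrm{ctr}$ earns $R(a,\mathrm{ctr})=\mathrm{ctr}\cdot\mathbb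 E_v[\sum_i p_i(v)]$ and moves the state according to $P(\cdot\mid a,\mathrm{ctr})=\sum_W \mathbb E_v[x_W(v)]\,P_W(\cdot\mid\mathrm{ctr})$. A policy $\pi$ assigns (measurably) an IC mechanism to every state. With a discount factor $\gamma\in[0,1)$ let $$V^\pi(\mathrm{ctr}_0)=\mathbb E\Big[\sum_{t\ge0}\gamma^tR(\pi(\mathrm{ctr}_t),\mathrm{ctr}_t)\Big],\quad \mathrm{ctr}_{t+1}\sim P(\cdot\mid\pi(\mathrm{ctr}_t),\mathrm{ctr}_t),\qquad V^*(\mathrm{ctr})=\sup_\pi V^\pi(\mathrm{ctr}).$$ A policy is optimal if $V^\pi(\mathrm{ctr})=V^*(\mathrm{ctr})$ for every $\mathrm{ctr}\in[0,1]$. The modified virtual welfare of a set $W$ is $$\Psi_W(\mathrm{ctr},v)=\mathrm{ctr}\cdot\sum_{i\in W}\phi_i(v_i)+\gamma\Big(\mathbb E_{\mathrm{ctr}'\sim P_W(\cdot\mid\mathrm{ctr})}[V^*(\mathrm{ctr}')]-\mathbb E_{\mathrm{ctr}'\sim P_\emptyset(\cdot\mid\mathrm{ctr})}[V^*(\mathrm{ctr}')]\Big)$$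 (with $0\cdot(-\infty)=0$). **Theorem.** Suppose that all value distributions are regular. Then $V^*$ is bounded and measurable, and in each state the optimal IC mechanism follows the rule: allocate to the set $W$ with $0<|W|\le k$ that maximizes $\Psi_W(\mathrm{ctr},v)$ if this maximum is positive, and do not allocate otherwise. Precisely: 1. there is an optimal policy whose mechanism, in every state $\mathrm{ctr}$ and on every profile $v\in\mathbb R_{\ge0}^n$, deterministically chooses a winning set according to the rule; 2. every policy of IC mechanisms that, in every state and on every profile $v\in\mathbb R_{\ge0}^n$, only chooses winning sets according to the rule (with any breaking of ties between maximizers) is optimal; 3. conversely, for every optimal policy, every state $\mathrm{ctr}$ and almost every value profile $v$, each winning set chosen with positive probability is one that the rule allows or, if the maximum is exactly $0$, a maximizer $W$ with $0<|W|\le k$. -/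

import Mathlib

open MeasureTheory ProbabilityTheory
open scoped ENNReal

namespace AdAuction

noncomputable section

/-- A user state: a click-through rate in `[0, 1]`. -/
abbrev State : Type := Set.Icc (0 : ℝ) 1

/-! ### Value distributions -/

/-- A distribution of a nonnegative value, given by its probability density. -/
structure ValueDist where
  pdf : ℝ → ℝ
  measurable_pdf : Measurable pdf
  pdf_nonneg : ∀ x, 0 ≤ pdf x
  pdf_eq_zero : ∀ x, x < 0 → pdf x = 0
  lintegral_pdf : ∫⁻ x, ENNReal.ofReal (pdf x) = 1

/-- The law on `ℝ` with the given density. -/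
def ValueDist.law (D : ValueDist) : Measure ℝ :=
  volume.withDensity fun x => ENNReal.ofReal (D.pdf x)

instance (D : ValueDist) : IsProbabilityMeasure D.law :=
  ⟨by rw [ValueDist.law, withDensity_apply _ MeasurableSet.univ, Measure.restrict_univ,
    D.lintegral_pdf]⟩

/-- The mean of the distribution is finite. -/
def ValueDist.FiniteMean (D : ValueDist) : Prop :=
  ∫⁻ x, ENNReal.ofReal x ∂D.law < ∞

/-- The virtual value `x - (1 - F x) / f x`. The quotient is taken in `ℝ≥0∞`, so that it is `∞`
where `f x = 0` and `F x < 1` (there the virtual value is `-∞`, as below the support), and it is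
`0` where `F x = 1`. -/
def ValueDist.virtualValue (D : ValueDist) (x : ℝ) : EReal :=
  (x : EReal) -
    ((ENNReal.ofReal (1 - cdf D.law x) / ENNReal.ofReal (D.pdf x) : ℝ≥0∞) : EReal)

/-- Regularity: the virtual value is non-decreasing on `[0, ∞)`. -/
def ValueDist.Regular (D : ValueDist) : Prop :=
  MonotoneOn D.virtualValue (Set.Ici 0)

/-! ### Incentive compatible mechanisms -/

/-- The probability that bidder `i` is among the winners, when `x W` is the probability that `W` is
the set of winners. -/
def marginal {n : ℕ} (x : Finset (Fin n) → ℝ) (i : Fin n) : ℝ :=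
  ∑ W with i ∈ W, x W

/-- A (possibly randomized) truthful mechanism for `n` bidders and `k` identical slots.
`alloc v W` is the probability that `W` is the set of winners on the bid profile `v`, and `pay v i`
is the expected payment of bidder `i` (per click). Only profiles of nonnegative bids matter. -/
structure Mechanism (n k : ℕ) where
  alloc : (Fin n → ℝ) → Finset (Fin n) → ℝ
  pay : (Fin n → ℝ) → Fin n → ℝ
  measurable_alloc : ∀ W, Measurable fun v => alloc v W
  measurable_pay : ∀ i, Measurable fun v => pay v i
  alloc_nonneg : ∀ v, 0 ≤ v → ∀ W, 0 ≤ alloc v W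
  alloc_sum : ∀ v, 0 ≤ v → ∑ W, alloc v W = 1
  alloc_card : ∀ v, 0 ≤ v → ∀ W : Finset (Fin n), k < W.card → alloc v W = 0
  pay_nonneg : ∀ v, 0 ≤ v → ∀ i, 0 ≤ pay v i
  /-- Individual rationality: a truthful bidder has nonnegative utility. -/
  rational : ∀ v, 0 ≤ v → ∀ i, 0 ≤ v i * marginal (alloc v) i - pay v i
  /-- Dominant strategy incentive compatibility. -/
  truthful : ∀ v, 0 ≤ v → ∀ i, ∀ b : ℝ, 0 ≤ b →
    v i * marginal (alloc (Function.update v i b)) i - pay (Function.update v i b) i ≤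
      v i * marginal (alloc v) i - pay v i

/-! ### The Markov decision process -/

/-- The data of the repeated auction with `n` bidders and `k` identical slots: the value
distributions, the transition probabilities of the state when the set `W` of ads is shown, and the
discount factor. -/
structure Model (n k : ℕ) where
  dist : Fin n → ValueDist
  trans : Finset (Fin n) → Kernel State State
  markov : ∀ W, IsMarkovKernel (trans W)
  γ : ℝ
  γ_nonneg : 0 ≤ γ
  γ_lt_one : γ < 1

/-- A stationary policy: a mechanism for each state, jointly measurable in state and bids. -/
structure Policy (n k : ℕ) where
  mech : State → Mechanism n k
  measurable_alloc : ∀ W, Measurable fun q : State × (Fin n → ℝ) => (mech q.1).alloc q.2 W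
  measurable_pay : ∀ i, Measurable fun q : State × (Fin n → ℝ) => (mech q.1).pay q.2 i

/-- The joint law of the (independent) values in a round. -/
def Model.valueLaw {n k : ℕ} (M : Model n k) : Measure (Fin n → ℝ) :=
  Measure.pi fun i => (M.dist i).law

instance {n k : ℕ} (M : Model n k) : IsProbabilityMeasure M.valueLaw := by
  unfold Model.valueLaw
  infer_instance

/-- The probability that `W` is the set of winners of the mechanism `a`. -/
def Model.winProb {n k : ℕ} (M : Model n k) (a : Mechanism n k) (W : Finset (Fin n)) : ℝ≥0∞ :=
  ∫⁻ v, ENNReal.ofReal (a.alloc v W) ∂M.valueLaw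

/-- The expected reward of the mechanism `a` in state `c`. -/
def Model.reward {n k : ℕ} (M : Model n k) (a : Mechanism n k) (c : State) : ℝ≥0∞ :=
  ENNReal.ofReal c * ∫⁻ v, ∑ i, ENNReal.ofReal (a.pay v i) ∂M.valueLaw

/-- The law of the next state: the mixture of the `trans W` over the winning sets `W`. -/
def Model.step {n k : ℕ} (M : Model n k) (π : Policy n k) : Kernel State State where
  toFun c := ∑ W, M.winProb (π.mech c) W • M.trans W c
  measurable' := by
    refine Measure.measurable_of_measurable_coe _ fun s hs => ?_
    simp only [Measure.coe_finsetSum, Finset.sum_apply, Measure.smul_apply, smul_eq_mul]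
    refine Finset.measurable_sum _ fun W _ => Measurable.mul ?_ ((M.trans W).measurable_coe hs)
    exact Measurable.lintegral_prod_right' (f := fun q : State × (Fin n → ℝ) =>
      ENNReal.ofReal ((π.mech q.1).alloc q.2 W)) (π.measurable_alloc W).ennreal_ofReal

/-- The law of the state in round `t` under the policy `π`, started in state `c`. -/
def Model.stateLaw {n k : ℕ} (M : Model n k) (π : Policy n k) (c : State) : ℕ → Measure State
  | 0 => Measure.dirac c
  | t + 1 => (M.stateLaw π c t).bind (M.step π)

/-- The long-term discounted revenue of the policy `π` started in state `c`, that is, the sum over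
the rounds `t` of `γ ^ t` times the expected reward in round `t`. -/
def Model.value {n k : ℕ} (M : Model n k) (π : Policy n k) (c : State) : ℝ≥0∞ :=
  ∑' t : ℕ, ENNReal.ofReal M.γ ^ t * ∫⁻ s, M.reward (π.mech s) s ∂M.stateLaw π c t

/-- The optimal value function. -/
def Model.optValue {n k : ℕ} (M : Model n k) (c : State) : ℝ≥0∞ :=
  ⨆ π : Policy n k, M.value π c

/-- A policy is optimal if it attains the optimal value in every state. -/
def Model.IsOptimal {n k : ℕ} (M : Model n k) (π : Policy n k) : Prop :=
  ∀ c, M.value π c = M.optValue c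

/-! ### Modified virtual welfare -/

/-- The expectation of the optimal value in the next state if `W` is shown in state `c`. -/
def Model.nextValue {n k : ℕ} (M : Model n k) (W : Finset (Fin n)) (c : State) : ℝ :=
  (∫⁻ s, M.optValue s ∂M.trans W c).toReal

/-- The modified virtual welfare of the set `W` in state `c` on the value profile `v`. -/
def Model.welfare {n k : ℕ} (M : Model n k) (c : State) (v : Fin n → ℝ) (W : Finset (Fin n)) :
    EReal :=
  ((c : ℝ) : EReal) * ∑ i ∈ W, (M.dist i).virtualValue (v i) +
    ((M.γ * (M.nextValue W c - M.nextValue ∅ c) : ℝ) : EReal)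

/-- `W` maximizes the modified virtual welfare among the nonempty sets of at most `k` bidders. -/
def Model.IsMaximizer {n k : ℕ} (M : Model n k) (c : State) (v : Fin n → ℝ)
    (W : Finset (Fin n)) : Prop :=
  0 < W.card ∧ W.card ≤ k ∧
    ∀ W' : Finset (Fin n), 0 < W'.card → W'.card ≤ k → M.welfare c v W' ≤ M.welfare c v W

/-- The outcome `W` obeys the rule: it is a maximizing set of positive modified virtual welfare, or
it is empty and no admissible nonempty set has positive modified virtual welfare. -/
def Model.Prescribed {n k : ℕ} (M : Model n k) (c : State) (v : Fin n → ℝ)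
    (W : Finset (Fin n)) : Prop :=
  (M.IsMaximizer c v W ∧ 0 < M.welfare c v W) ∨
    (W = ∅ ∧ ∀ W' : Finset (Fin n), 0 < W'.card → W'.card ≤ k → M.welfare c v W' ≤ 0)

end

end AdAuction

open AdAuction

/-! The proof combines Myerson's virtual-value argument within a round with dynamic programming
across rounds.

Within a round, truthfulness makes a bidder's win probability q a subgradient of the utility along
the bid, so q is monotone and the utility is its integral. Individual rationality and nonnegative
payments force utility zero at bid zero, so the payment is determined (`Mechanism.pay_eq`). Taking
expectations and exchanging integrals turns the integral of q into the inverse hazard rate times q.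
Expected payment is therefore at most expected virtual value won (`Model.integral_pay_le`), with
equality if bidders of virtual value -∞ never win (`Model.integral_pay`). With continuation values d
W normalised by d ∅ = 0, revenue plus continuation is thus bounded by the mean of the pointwise
maximal score. Any mechanism obeying the rule attains the bound, and any mechanism attaining it
picks maximal scores almost surely. Truthful mechanisms obeying the rule exist: with a fixed
priority for ties, regularity makes the greedy winner monotone in the own bid
(`IsGreedy.mem_of_le`), and envelope payments make it truthful.

Across rounds, the one-round result gives the Bellman operator a measurable closed form
(`Model.bellman_eq`). Value iteration from 0 increases to a bounded fixed point
(`Model.bellman_limitValue`). Telescoping discounted sums shows that no policy exceeds this fixed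
point and that every policy attaining the Bellman maximum in each state reaches it. So it is the
optimal value, and the one-round characterisation of maximizers gives all the claims about policies.
-/

namespace AdAuction

noncomputable section

variable {n k : ℕ}

/-! ### The inverse hazard rate -/

/-- The inverse hazard rate `(1 - F x) / f x`. -/
def ValueDist.invHazard (D : ValueDist) (x : ℝ) : ℝ≥0∞ :=
  ENNReal.ofReal (1 - cdf D.law x) / ENNReal.ofReal (D.pdf x)

/-- The virtual value as a real number, meaningful where the inverse hazard rate is finite. -/
def ValueDist.realVirtual (D : ValueDist) (x : ℝ) : ℝ := x - (D.invHazard x).toReal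

lemma ValueDist.virtualValue_eq_coe (D : ValueDist) {x : ℝ} (h : D.invHazard x ≠ ∞) :
    D.virtualValue x = (D.realVirtual x : EReal) := by
  change (x : EReal) - ((D.invHazard x : ℝ≥0∞) : EReal) = _
  rw [ValueDist.realVirtual, EReal.coe_sub, EReal.coe_ennreal_toReal h]

lemma ValueDist.virtualValue_eq_bot (D : ValueDist) {x : ℝ} (h : D.invHazard x = ∞) :
    D.virtualValue x = ⊥ := by
  change (x : EReal) - ((D.invHazard x : ℝ≥0∞) : EReal) = _
  rw [h]
  simp

lemma ValueDist.measurable_invHazard (D : ValueDist) : Measurable D.invHazard :=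
  ((measurable_const.sub (monotone_cdf D.law).measurable).ennreal_ofReal).div
    D.measurable_pdf.ennreal_ofReal

lemma ValueDist.measurable_realVirtual (D : ValueDist) : Measurable D.realVirtual :=
  measurable_id.sub D.measurable_invHazard.ennreal_toReal

lemma ValueDist.measurable_virtualValue (D : ValueDist) : Measurable D.virtualValue := by
  change Measurable fun x : ℝ => (x : EReal) - ((D.invHazard x : ℝ≥0∞) : EReal)
  simp only [sub_eq_add_neg]
  exact measurable_coe_real_ereal.add D.measurable_invHazard.coe_ereal_ennreal.neg

lemma ValueDist.lintegral_law (D : ValueDist) {g : ℝ → ℝ≥0∞} (hg : Measurable g) :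
    ∫⁻ x, g x ∂D.law = ∫⁻ x, ENNReal.ofReal (D.pdf x) * g x := by
  rw [ValueDist.law, lintegral_withDensity_eq_lintegral_mul _ D.measurable_pdf.ennreal_ofReal hg]
  rfl

lemma ValueDist.ae_pdf_ne_zero (D : ValueDist) : ∀ᵐ x ∂D.law, D.pdf x ≠ 0 := by
  rw [ValueDist.law, ae_withDensity_iff D.measurable_pdf.ennreal_ofReal]
  refine Filter.Eventually.of_forall fun x hx h => hx ?_
  rw [h, ENNReal.ofReal_zero]

lemma ValueDist.ae_nonneg (D : ValueDist) : ∀ᵐ x ∂D.law, 0 ≤ x := by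
  filter_upwards [D.ae_pdf_ne_zero] with x hx
  by_contra h
  exact hx (D.pdf_eq_zero x (not_le.1 h))

lemma ValueDist.ae_invHazard_ne_top (D : ValueDist) : ∀ᵐ x ∂D.law, D.invHazard x ≠ ∞ := by
  filter_upwards [D.ae_pdf_ne_zero] with x hx
  have : ENNReal.ofReal (D.pdf x) ≠ 0 := by
    rw [Ne, ENNReal.ofReal_eq_zero, not_le]
    exact lt_of_le_of_ne (D.pdf_nonneg x) (Ne.symm hx)
  exact ENNReal.div_ne_top ENNReal.ofReal_ne_top this

lemma ValueDist.law_Ioi (D : ValueDist) (z : ℝ) :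
    D.law (Set.Ioi z) = ENNReal.ofReal (1 - cdf D.law z) := by
  rw [← Set.compl_Iic, prob_compl_eq_one_sub measurableSet_Iic, ← ofReal_cdf,
    ENNReal.ofReal_sub _ (cdf_nonneg _ _), ENNReal.ofReal_one]

/-- Tonelli: a level z > 0 is counted with the mass of the values above z, which is 1 - F z. -/
lemma ValueDist.lintegral_lintegral_Ioo (D : ValueDist) {q : ℝ → ℝ≥0∞} (hq : Measurable q) :
    ∫⁻ x, (∫⁻ z in Set.Ioo 0 x, q z) ∂D.law =
      ∫⁻ z in Set.Ioi 0, q z * ENNReal.ofReal (1 - cdf D.law z) := by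
  have hS : MeasurableSet {p : ℝ × ℝ | 0 < p.2 ∧ p.2 < p.1} :=
    (measurableSet_lt measurable_const measurable_snd).inter
      (measurableSet_lt measurable_snd measurable_fst)
  have h1 : ∀ x : ℝ, ∫⁻ z in Set.Ioo 0 x, q z =
      ∫⁻ z, {p : ℝ × ℝ | 0 < p.2 ∧ p.2 < p.1}.indicator (fun p => q p.2) (x, z) := by
    intro x
    rw [← lintegral_indicator measurableSet_Ioo]
    rfl
  simp_rw [h1]
  rw [lintegral_lintegral_swap (f := fun x z =>
    {p : ℝ × ℝ | 0 < p.2 ∧ p.2 < p.1}.indicator (fun p => q p.2) (x, z))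
    ((hq.comp measurable_snd).indicator hS).aemeasurable,
    ← lintegral_indicator measurableSet_Ioi]
  refine lintegral_congr fun z => ?_
  by_cases hz : 0 < z
  · rw [Set.indicator_of_mem (Set.mem_Ioi.2 hz), ← D.law_Ioi z,
      ← lintegral_indicator_const measurableSet_Ioi]
    refine lintegral_congr fun x => ?_
    by_cases hx : z < x
    · rw [Set.indicator_of_mem (Set.mem_Ioi.2 hx), Set.indicator_of_mem]
      exact ⟨hz, hx⟩
    · rw [Set.indicator_of_notMem (fun h => hx (Set.mem_Ioi.1 h)), Set.indicator_of_notMem]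
      exact fun h => hx h.2
  · rw [Set.indicator_of_notMem (fun h => hz (Set.mem_Ioi.1 h))]
    rw [← lintegral_zero (μ := D.law)]
    refine lintegral_congr fun x => ?_
    rw [Set.indicator_of_notMem]
    exact fun h => hz h.1

lemma ValueDist.lintegral_invHazard_mul_eq (D : ValueDist) {q : ℝ → ℝ≥0∞} (hq : Measurable q) :
    ∫⁻ x, D.invHazard x * q x ∂D.law =
      ∫⁻ x in Set.Ioi 0, ENNReal.ofReal (D.pdf x) * (D.invHazard x * q x) := by
  rw [D.lintegral_law (g := fun x => D.invHazard x * q x) (D.measurable_invHazard.mul hq),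
    restrict_Ioi_eq_restrict_Ici,
    ← lintegral_indicator measurableSet_Ici]
  refine lintegral_congr fun x => ?_
  by_cases hx : 0 ≤ x
  · rw [Set.indicator_of_mem (Set.mem_Ici.2 hx)]
  · rw [Set.indicator_of_notMem (fun h => hx (Set.mem_Ici.1 h)), D.pdf_eq_zero x (not_le.1 hx)]
    simp

/-- The density times the inverse hazard rate is at most 1 - F. The inequality is strict only where
the density vanishes while F < 1; such points are null for the law but may carry Lebesgue measure.
-/
lemma ValueDist.lintegral_invHazard_mul_le (D : ValueDist) {q : ℝ → ℝ≥0∞} (hq : Measurable q) :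
    ∫⁻ x, D.invHazard x * q x ∂D.law ≤ ∫⁻ x, (∫⁻ z in Set.Ioo 0 x, q z) ∂D.law := by
  rw [D.lintegral_invHazard_mul_eq hq, D.lintegral_lintegral_Ioo hq]
  refine lintegral_mono fun x => ?_
  rw [← mul_assoc, mul_comm (q x)]
  gcongr
  exact ENNReal.mul_div_le

/-- The loss in the preceding inequality sits on the points of infinite inverse hazard rate, and
there q vanishes by hypothesis. -/
lemma ValueDist.lintegral_invHazard_mul (D : ValueDist) {q : ℝ → ℝ≥0∞} (hq : Measurable q)
    (h0 : ∀ x, 0 ≤ x → D.invHazard x = ∞ → q x = 0) :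
    ∫⁻ x, D.invHazard x * q x ∂D.law = ∫⁻ x, (∫⁻ z in Set.Ioo 0 x, q z) ∂D.law := by
  rw [D.lintegral_invHazard_mul_eq hq, D.lintegral_lintegral_Ioo hq]
  refine setLIntegral_congr_fun measurableSet_Ioi fun x hx => ?_
  by_cases hH : D.invHazard x = ∞
  · simp [h0 x (le_of_lt hx) hH]
  · rw [← mul_assoc, mul_comm (q x)]
    congr 1
    by_cases hf : ENNReal.ofReal (D.pdf x) = 0
    · rw [ValueDist.invHazard, hf] at hH
      have : ENNReal.ofReal (1 - cdf D.law x) = 0 := by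
        by_contra h
        exact hH (ENNReal.div_zero h)
      rw [hf, this, zero_mul]
    · exact ENNReal.mul_div_cancel hf ENNReal.ofReal_ne_top

/-- For q = 1 the inner integral over (0, x) is x, so the mean is an upper bound. -/
lemma ValueDist.lintegral_invHazard_ne_top (D : ValueDist) (hm : D.FiniteMean) :
    ∫⁻ x, D.invHazard x ∂D.law ≠ ∞ := by
  have h := D.lintegral_invHazard_mul_le (q := fun _ => 1) measurable_const
  simp only [mul_one, lintegral_const, MeasurableSet.univ, Measure.restrict_apply, Set.univ_inter,
    Real.volume_Ioo, one_mul, sub_zero] at h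
  exact (h.trans_lt hm).ne

/-! ### The payment identity -/

/-- The envelope formula: a function with monotone subgradient `q` is the integral of `q`. -/
lemma eq_integral_of_subgradient {u q : ℝ → ℝ} (hq : MonotoneOn q (Set.Ici 0))
    (hu : ∀ a b, 0 ≤ a → 0 ≤ b → u b + (a - b) * q b ≤ u a) (h0 : u 0 = 0) {x : ℝ} (hx : 0 ≤ x) :
    u x = ∫ z in (0 : ℝ)..x, q z := by
  have hint : ∀ a b, 0 ≤ a → 0 ≤ b → IntervalIntegrable q volume a b := fun a b ha hb =>
    (hq.mono fun z hz => (le_min ha hb).trans hz.1).intervalIntegrable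
  set d : ℝ → ℝ := fun y => u y - ∫ z in (0 : ℝ)..y, q z with hd
  -- Both the increment of u and the integral of q over [a, b] lie between (b - a) q a and (b - a) q
  -- b. No continuity of q is needed.
  have hstep : ∀ a b, 0 ≤ a → a ≤ b → |d b - d a| ≤ (b - a) * (q b - q a) := by
    intro a b ha hab
    have hb := ha.trans hab
    have e : d b - d a = u b - u a - ∫ z in a..b, q z := by
      rw [hd, ← intervalIntegral.integral_interval_sub_left (hint 0 b le_rfl hb)
        (hint 0 a le_rfl ha)]
      ring
    have l1 : (b - a) * q a ≤ ∫ z in a..b, q z := by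
      have := intervalIntegral.integral_mono_on hab (by simp) (hint a b ha hb)
        (f := fun _ => q a) (fun z hz => hq ha (ha.trans hz.1) hz.1)
      simpa using this
    have l2 : ∫ z in a..b, q z ≤ (b - a) * q b := by
      have := intervalIntegral.integral_mono_on hab (hint a b ha hb) (by simp)
        (g := fun _ => q b) (fun z hz => hq (ha.trans hz.1) hb hz.2)
      simpa using this
    have u1 := hu a b ha hb
    have u2 := hu b a hb ha
    rw [e, abs_le]
    constructor <;> nlinarith
  -- Cut [0, x] into m + 1 equal pieces: all factors b - a coincide, so the increments of q
  -- telescope and the total error is O(1/m).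
  have hbound : ∀ m : ℕ, |d x| ≤ x / (m + 1) * (q x - q 0) := by
    intro m
    have hm : (0 : ℝ) < m + 1 := by positivity
    set y : ℕ → ℝ := fun j => x / (m + 1) * j with hy
    have hs : d x = ∑ j ∈ Finset.range (m + 1), (d (y (j + 1)) - d (y j)) := by
      rw [Finset.sum_range_sub (fun j => d (y j))]
      have e0 : y 0 = 0 := by simp [hy]
      have e1 : y (m + 1) = x := by
        simp only [hy]
        push_cast
        field_simp
      rw [e0, e1]
      simp [hd, h0]
    have hq' : q x - q 0 = ∑ j ∈ Finset.range (m + 1), (q (y (j + 1)) - q (y j)) := by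
      rw [Finset.sum_range_sub (fun j => q (y j))]
      have e0 : y 0 = 0 := by simp [hy]
      have e1 : y (m + 1) = x := by
        simp only [hy]
        push_cast
        field_simp
      rw [e0, e1]
    rw [hs, hq', Finset.mul_sum]
    refine (Finset.abs_sum_le_sum_abs _ _).trans (Finset.sum_le_sum fun j _ => ?_)
    have hj : y (j + 1) - y j = x / (m + 1) := by
      simp only [hy]
      push_cast
      ring
    have hx' : 0 ≤ x / (m + 1) := by positivity
    rw [← hj]
    exact hstep _ _ (by simp only [hy]; positivity) (by linarith)
  have hlim : Filter.Tendsto (fun m : ℕ => x / ((m : ℝ) + 1) * (q x - q 0)) Filter.atTop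
      (nhds 0) := by
    have := (tendsto_one_div_add_atTop_nhds_zero_nat (𝕜 := ℝ)).const_mul (x * (q x - q 0))
    rw [mul_zero] at this
    refine this.congr fun m => ?_
    ring
  have : |d x| ≤ 0 := ge_of_tendsto' hlim hbound
  have := abs_nonpos_iff.1 this
  simp only [hd] at this
  linarith

/-! ### Truthful mechanisms along the bid of one bidder. -/

lemma Mechanism.marginal_nonneg (a : Mechanism n k) {v : Fin n → ℝ} (hv : 0 ≤ v) (i : Fin n) :
    0 ≤ marginal (a.alloc v) i :=
  Finset.sum_nonneg fun W _ => a.alloc_nonneg v hv W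

lemma Mechanism.marginal_le_one (a : Mechanism n k) {v : Fin n → ℝ} (hv : 0 ≤ v) (i : Fin n) :
    marginal (a.alloc v) i ≤ 1 :=
  (Finset.sum_le_sum_of_subset_of_nonneg (Finset.filter_subset _ _)
    fun W _ _ => a.alloc_nonneg v hv W).trans (a.alloc_sum v hv).le

lemma Mechanism.measurable_marginal (a : Mechanism n k) (i : Fin n) :
    Measurable fun v => marginal (a.alloc v) i :=
  Finset.measurable_sum _ fun W _ => a.measurable_alloc W

lemma update_nonneg {v : Fin n → ℝ} (hv : 0 ≤ v) (i : Fin n) {z : ℝ} (hz : 0 ≤ z) :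
    0 ≤ Function.update v i z := by
  intro j
  by_cases h : j = i
  · subst h
    simpa using hz
  · simpa [h] using hv j

lemma Mechanism.marginal_subgradient (a : Mechanism n k) {v : Fin n → ℝ} (hv : 0 ≤ v)
    (i : Fin n) {y z : ℝ} (hy : 0 ≤ y) (hz : 0 ≤ z) :
    (z * marginal (a.alloc (Function.update v i z)) i - a.pay (Function.update v i z) i) +
        (y - z) * marginal (a.alloc (Function.update v i z)) i ≤
      y * marginal (a.alloc (Function.update v i y)) i - a.pay (Function.update v i y) i := by
  have := a.truthful (Function.update v i y) (update_nonneg hv i hy) i z hz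
  simp only [Function.update_idem, Function.update_self] at this
  linarith

/-- Add the truthfulness inequalities of y against z and of z against y: the utilities cancel,
leaving the product of the two increments nonnegative. -/
lemma Mechanism.monotoneOn_marginal (a : Mechanism n k) {v : Fin n → ℝ} (hv : 0 ≤ v)
    (i : Fin n) :
    MonotoneOn (fun z => marginal (a.alloc (Function.update v i z)) i) (Set.Ici 0) := by
  intro y hy z hz hyz
  have h1 := a.marginal_subgradient hv i (y := y) (z := z) hy hz
  have h2 := a.marginal_subgradient hv i (y := z) (z := y) hz hy
  rcases hyz.eq_or_lt with rfl | hlt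
  · rfl
  · dsimp only
    nlinarith

lemma Mechanism.pay_le (a : Mechanism n k) {v : Fin n → ℝ} (hv : 0 ≤ v) (i : Fin n) :
    a.pay v i ≤ v i := by
  have := a.rational v hv i
  have := mul_le_mul_of_nonneg_left (a.marginal_le_one hv i) (hv i)
  linarith

/-- The envelope formula applied to the utility along bid i. Its normalisation at bid 0 comes from
the two sign conditions: the payment is nonnegative, and rationality at value 0 bounds it by 0. -/
lemma Mechanism.pay_eq (a : Mechanism n k) {v : Fin n → ℝ} (hv : 0 ≤ v) (i : Fin n) :
    a.pay v i = v i * marginal (a.alloc v) i -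
      ∫ z in (0 : ℝ)..v i, marginal (a.alloc (Function.update v i z)) i := by
  have h := eq_integral_of_subgradient (a.monotoneOn_marginal hv i)
    (u := fun z => z * marginal (a.alloc (Function.update v i z)) i -
      a.pay (Function.update v i z) i)
    (fun y z hy hz => a.marginal_subgradient hv i hy hz) ?_ (hv i)
  · simp only [Function.update_eq_self] at h
    linarith
  · have h0 := update_nonneg hv i le_rfl
    have h1 := a.pay_nonneg _ h0 i
    have h2 := a.rational _ h0 i
    simp only [Function.update_self, zero_mul] at h2 ⊢
    linarith

/-- The payment identity in terms of `∫⁻`. -/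
lemma Mechanism.ofReal_pay_add (a : Mechanism n k) {v : Fin n → ℝ} (hv : 0 ≤ v) (i : Fin n) :
    ENNReal.ofReal (a.pay v i) +
      (∫⁻ z in Set.Ioo 0 (v i), ENNReal.ofReal (marginal (a.alloc (Function.update v i z)) i)) =
      ENNReal.ofReal (v i * marginal (a.alloc v) i) := by
  have hvi : (0 : ℝ) ≤ v i := hv i
  have hnn : ∀ z ∈ Set.Ioc 0 (v i), 0 ≤ marginal (a.alloc (Function.update v i z)) i :=
    fun z hz => a.marginal_nonneg (update_nonneg hv i hz.1.le) i
  have hint : IntervalIntegrable (fun z => marginal (a.alloc (Function.update v i z)) i)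
      volume 0 (v i) :=
    ((a.monotoneOn_marginal hv i).mono fun z hz =>
      (le_min le_rfl (hv i)).trans hz.1).intervalIntegrable
  have e : (∫⁻ z in Set.Ioo 0 (v i),
      ENNReal.ofReal (marginal (a.alloc (Function.update v i z)) i)) =
      ENNReal.ofReal (∫ z in (0 : ℝ)..v i, marginal (a.alloc (Function.update v i z)) i) := by
    rw [intervalIntegral.integral_of_le hvi, ofReal_integral_eq_lintegral_ofReal,
      restrict_Ioo_eq_restrict_Ioc]
    · exact (intervalIntegrable_iff_integrableOn_Ioc_of_le hvi).1 hint
    · exact (ae_restrict_iff' measurableSet_Ioc).2 (Filter.Eventually.of_forall hnn)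
  rw [e, ← ENNReal.ofReal_add (a.pay_nonneg v hv i), a.pay_eq hv i]
  · congr 1
    ring
  · rw [intervalIntegral.integral_of_le hvi]
    exact setIntegral_nonneg measurableSet_Ioc hnn

/-! ### Expected payments -/

lemma Model.measurePreserving_eval (M : Model n k) (i : Fin n) :
    MeasurePreserving (Function.eval i) M.valueLaw (M.dist i).law :=
  MeasureTheory.measurePreserving_eval _ i

lemma Model.ae_nonneg (M : Model n k) : ∀ᵐ v ∂M.valueLaw, 0 ≤ v := by
  have : ∀ i, ∀ᵐ v ∂M.valueLaw, 0 ≤ v i := fun i =>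
    (M.measurePreserving_eval i).quasiMeasurePreserving.ae (M.dist i).ae_nonneg
  filter_upwards [ae_all_iff.2 this] with v hv using hv

lemma Model.ae_invHazard_ne_top (M : Model n k) :
    ∀ᵐ v ∂M.valueLaw, ∀ i, (M.dist i).invHazard (v i) ≠ ∞ :=
  ae_all_iff.2 fun i =>
    (M.measurePreserving_eval i).quasiMeasurePreserving.ae (M.dist i).ae_invHazard_ne_top

lemma measurable_update_prod (i : Fin n) :
    Measurable fun p : (Fin n → ℝ) × ℝ => Function.update p.1 i p.2 := by
  refine measurable_pi_iff.2 fun j => ?_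
  by_cases h : j = i
  · subst h
    simpa using measurable_snd
  · simp only [Function.update_of_ne h]
    exact (measurable_pi_apply j).comp measurable_fst

lemma measurable_lintegral_Ioo_update {g : (Fin n → ℝ) → ℝ≥0∞} (hg : Measurable g) (i : Fin n) :
    Measurable fun v : Fin n → ℝ => ∫⁻ z in Set.Ioo 0 (v i), g (Function.update v i z) := by
  have hS : MeasurableSet {p : (Fin n → ℝ) × ℝ | 0 < p.2 ∧ p.2 < p.1 i} :=
    (measurableSet_lt measurable_const measurable_snd).inter
      (measurableSet_lt measurable_snd ((measurable_pi_apply i).comp measurable_fst))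
  have h := ((hg.comp (measurable_update_prod i)).indicator hS).lintegral_prod_right'
    (ν := (volume : Measure ℝ))
  convert h using 2 with v
  rw [← lintegral_indicator measurableSet_Ioo]
  rfl

/-- By independence it suffices to integrate out coordinate i with the other bids fixed, which is
the one-dimensional inequality. -/
lemma Model.lintegral_invHazard_mul_le (M : Model n k) {g : (Fin n → ℝ) → ℝ≥0∞}
    (hg : Measurable g) (i : Fin n) :
    ∫⁻ v, (M.dist i).invHazard (v i) * g v ∂M.valueLaw ≤
      ∫⁻ v, (∫⁻ z in Set.Ioo 0 (v i), g (Function.update v i z)) ∂M.valueLaw := by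
  refine lintegral_le_of_lmarginal_le {i}
    (((M.dist i).measurable_invHazard.comp (measurable_pi_apply i)).mul hg)
    (measurable_lintegral_Ioo_update hg i) fun v => ?_
  simp only [lmarginal_singleton, Function.update_self, Function.update_idem]
  exact (M.dist i).lintegral_invHazard_mul_le (hg.comp (measurable_update v))

lemma Model.lintegral_invHazard_mul (M : Model n k) {g : (Fin n → ℝ) → ℝ≥0∞}
    (hg : Measurable g) (i : Fin n)
    (h0 : ∀ v : Fin n → ℝ, 0 ≤ v i → (M.dist i).invHazard (v i) = ∞ → g v = 0) :
    ∫⁻ v, (M.dist i).invHazard (v i) * g v ∂M.valueLaw =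
      ∫⁻ v, (∫⁻ z in Set.Ioo 0 (v i), g (Function.update v i z)) ∂M.valueLaw := by
  refine lintegral_eq_of_lmarginal_eq {i}
    (((M.dist i).measurable_invHazard.comp (measurable_pi_apply i)).mul hg)
    (measurable_lintegral_Ioo_update hg i) (funext fun v => ?_)
  simp only [lmarginal_singleton, Function.update_self, Function.update_idem]
  refine (M.dist i).lintegral_invHazard_mul (hg.comp (measurable_update v)) fun x hx hH => ?_
  exact h0 _ (by simpa using hx) (by simpa using hH)

lemma Model.integrable_eval (M : Model n k) (hmean : ∀ i, (M.dist i).FiniteMean) (i : Fin n) :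
    Integrable (fun v => v i) M.valueLaw := by
  have h : Integrable (fun x : ℝ => x) (M.dist i).law := by
    refine ⟨measurable_id.aestronglyMeasurable, ?_⟩
    rw [hasFiniteIntegral_iff_ofReal (M.dist i).ae_nonneg]
    exact hmean i
  exact (M.measurePreserving_eval i).integrable_comp_of_integrable h

lemma Model.integrable_invHazard (M : Model n k) (hmean : ∀ i, (M.dist i).FiniteMean)
    (i : Fin n) : Integrable (fun v => ((M.dist i).invHazard (v i)).toReal) M.valueLaw := by
  have h : Integrable (fun x : ℝ => ((M.dist i).invHazard x).toReal) (M.dist i).law :=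
    integrable_toReal_of_lintegral_ne_top (M.dist i).measurable_invHazard.aemeasurable
      ((M.dist i).lintegral_invHazard_ne_top (hmean i))
  exact (M.measurePreserving_eval i).integrable_comp_of_integrable h

lemma Model.integrable_realVirtual (M : Model n k) (hmean : ∀ i, (M.dist i).FiniteMean)
    (i : Fin n) : Integrable (fun v => (M.dist i).realVirtual (v i)) M.valueLaw :=
  (M.integrable_eval hmean i).sub (M.integrable_invHazard hmean i)

lemma Model.ae_abs_marginal_le (M : Model n k) (a : Mechanism n k) (i : Fin n) :
    ∀ᵐ v ∂M.valueLaw, ‖marginal (a.alloc v) i‖ ≤ 1 := by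
  filter_upwards [M.ae_nonneg] with v hv
  rw [Real.norm_of_nonneg (a.marginal_nonneg hv i)]
  exact a.marginal_le_one hv i

lemma Model.integrable_mul_marginal (M : Model n k) (a : Mechanism n k) (i : Fin n)
    {f : (Fin n → ℝ) → ℝ} (hf : Integrable f M.valueLaw) :
    Integrable (fun v => f v * marginal (a.alloc v) i) M.valueLaw :=
  hf.mul_bdd (c := 1) (a.measurable_marginal i).aestronglyMeasurable (M.ae_abs_marginal_le a i)

lemma Model.integrable_pay (M : Model n k) (hmean : ∀ i, (M.dist i).FiniteMean)
    (a : Mechanism n k) (i : Fin n) : Integrable (fun v => a.pay v i) M.valueLaw := by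
  refine (M.integrable_eval hmean i).mono' (a.measurable_pay i).aestronglyMeasurable ?_
  filter_upwards [M.ae_nonneg] with v hv
  rw [Real.norm_of_nonneg (a.pay_nonneg v hv i)]
  exact a.pay_le hv i

lemma Model.integrable_alloc (M : Model n k) (a : Mechanism n k) (W : Finset (Fin n)) :
    Integrable (fun v => a.alloc v W) M.valueLaw := by
  refine (integrable_const (1 : ℝ)).mono' (a.measurable_alloc W).aestronglyMeasurable ?_
  filter_upwards [M.ae_nonneg] with v hv
  rw [Real.norm_of_nonneg (a.alloc_nonneg v hv W), ← a.alloc_sum v hv]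
  exact Finset.single_le_sum (f := fun W => a.alloc v W)
    (fun W _ => a.alloc_nonneg v hv W) (Finset.mem_univ W)

/-- The expected payment of a bidder, as the expected value won minus the expected utility. -/
lemma Model.integral_pay_eq (M : Model n k) (hmean : ∀ i, (M.dist i).FiniteMean)
    (a : Mechanism n k) (i : Fin n) :
    (∫⁻ v, (∫⁻ z in Set.Ioo 0 (v i),
      ENNReal.ofReal (marginal (a.alloc (Function.update v i z)) i)) ∂M.valueLaw) ≠ ∞ ∧
    ∫ v, a.pay v i ∂M.valueLaw = (∫ v, v i * marginal (a.alloc v) i ∂M.valueLaw) -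
      (∫⁻ v, (∫⁻ z in Set.Ioo 0 (v i),
        ENNReal.ofReal (marginal (a.alloc (Function.update v i z)) i)) ∂M.valueLaw).toReal := by
  set B := ∫⁻ v, (∫⁻ z in Set.Ioo 0 (v i),
      ENNReal.ofReal (marginal (a.alloc (Function.update v i z)) i)) ∂M.valueLaw
  have hC := M.integrable_mul_marginal a i (M.integrable_eval hmean i)
  have hCnn : 0 ≤ᵐ[M.valueLaw] fun v => v i * marginal (a.alloc v) i := by
    filter_upwards [M.ae_nonneg] with v hv using mul_nonneg (hv i) (a.marginal_nonneg hv i)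
  have hPnn : 0 ≤ᵐ[M.valueLaw] fun v => a.pay v i := by
    filter_upwards [M.ae_nonneg] with v hv using a.pay_nonneg v hv i
  have key : (∫⁻ v, ENNReal.ofReal (a.pay v i) ∂M.valueLaw) + B =
      ∫⁻ v, ENNReal.ofReal (v i * marginal (a.alloc v) i) ∂M.valueLaw := by
    rw [← lintegral_add_left (a.measurable_pay i).ennreal_ofReal]
    refine lintegral_congr_ae ?_
    filter_upwards [M.ae_nonneg] with v hv using a.ofReal_pay_add hv i
  rw [← ofReal_integral_eq_lintegral_ofReal hC hCnn,
    ← ofReal_integral_eq_lintegral_ofReal (M.integrable_pay hmean a i) hPnn] at key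
  -- The right side of `key` is finite because the mean is, so B may be subtracted.
  have hB : B ≠ ∞ := fun h => by simp [h] at key
  refine ⟨hB, ?_⟩
  have := congrArg ENNReal.toReal key
  rw [ENNReal.toReal_add ENNReal.ofReal_ne_top hB,
    ENNReal.toReal_ofReal (integral_nonneg_of_ae hPnn),
    ENNReal.toReal_ofReal (integral_nonneg_of_ae hCnn)] at this
  linarith

lemma Model.integral_invHazard_mul_marginal (M : Model n k) (a : Mechanism n k) (i : Fin n) :
    ∫ v, ((M.dist i).invHazard (v i)).toReal * marginal (a.alloc v) i ∂M.valueLaw =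
      (∫⁻ v, (M.dist i).invHazard (v i) * ENNReal.ofReal (marginal (a.alloc v) i)
        ∂M.valueLaw).toReal := by
  rw [← integral_toReal]
  · refine integral_congr_ae ?_
    filter_upwards [M.ae_nonneg] with v hv
    rw [ENNReal.toReal_mul, ENNReal.toReal_ofReal (a.marginal_nonneg hv i)]
  · exact (((M.dist i).measurable_invHazard.comp (measurable_pi_apply i)).mul
      (a.measurable_marginal i).ennreal_ofReal).aemeasurable
  · filter_upwards [M.ae_invHazard_ne_top] with v hv
    exact ENNReal.mul_lt_top (hv i).lt_top ENNReal.ofReal_lt_top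

lemma Model.integral_realVirtual_mul_marginal (M : Model n k)
    (hmean : ∀ i, (M.dist i).FiniteMean) (a : Mechanism n k) (i : Fin n) :
    ∫ v, (M.dist i).realVirtual (v i) * marginal (a.alloc v) i ∂M.valueLaw =
      (∫ v, v i * marginal (a.alloc v) i ∂M.valueLaw) -
      (∫⁻ v, (M.dist i).invHazard (v i) * ENNReal.ofReal (marginal (a.alloc v) i)
        ∂M.valueLaw).toReal := by
  rw [← M.integral_invHazard_mul_marginal, ← integral_sub
    (M.integrable_mul_marginal a i (M.integrable_eval hmean i))
    (M.integrable_mul_marginal a i (M.integrable_invHazard hmean i))]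
  refine integral_congr_ae (Filter.Eventually.of_forall fun v => ?_)
  simp only [ValueDist.realVirtual]
  ring

/-- The expected payment is at most the expected virtual value won. -/
lemma Model.integral_pay_le (M : Model n k) (hmean : ∀ i, (M.dist i).FiniteMean)
    (a : Mechanism n k) (i : Fin n) :
    ∫ v, a.pay v i ∂M.valueLaw ≤
      ∫ v, (M.dist i).realVirtual (v i) * marginal (a.alloc v) i ∂M.valueLaw := by
  obtain ⟨hB, h⟩ := M.integral_pay_eq hmean a i
  rw [h, M.integral_realVirtual_mul_marginal hmean]
  have := ENNReal.toReal_mono hB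
    (M.lintegral_invHazard_mul_le (a.measurable_marginal i).ennreal_ofReal i)
  linarith

/-- The expected payment is the expected virtual value won, if a bidder of virtual value `-∞` never
wins. -/
lemma Model.integral_pay (M : Model n k) (hmean : ∀ i, (M.dist i).FiniteMean)
    (a : Mechanism n k) (i : Fin n)
    (h0 : ∀ v, 0 ≤ v → (M.dist i).invHazard (v i) = ∞ → marginal (a.alloc v) i = 0) :
    ∫ v, a.pay v i ∂M.valueLaw =
      ∫ v, (M.dist i).realVirtual (v i) * marginal (a.alloc v) i ∂M.valueLaw := by
  rw [(M.integral_pay_eq hmean a i).2, M.integral_realVirtual_mul_marginal hmean]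
  congr 2
  -- `h0` speaks only of nonnegative profiles, whereas the identity to be applied asks for vanishing
  -- whenever the single coordinate v i is nonnegative. Cutting off with an indicator bridges this,
  -- and changes nothing almost everywhere.
  have hS : MeasurableSet {v : Fin n → ℝ | 0 ≤ v} := measurableSet_Ici
  have hg := ((a.measurable_marginal i).ennreal_ofReal).indicator hS
  have h := M.lintegral_invHazard_mul hg i fun v _ hH => by
    by_cases hv : 0 ≤ v
    · rw [Set.indicator_of_mem (by exact hv), h0 v hv hH, ENNReal.ofReal_zero]
    · rw [Set.indicator_of_notMem (by exact hv)]
  calc _ = _ := ?_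
    _ = _ := h.symm
    _ = _ := ?_
  · refine lintegral_congr_ae ?_
    filter_upwards [M.ae_nonneg] with v hv
    refine setLIntegral_congr_fun measurableSet_Ioo fun z hz => ?_
    rw [Set.indicator_of_mem (update_nonneg hv i hz.1.le)]
  · refine lintegral_congr_ae ?_
    filter_upwards [M.ae_nonneg] with v hv
    rw [Set.indicator_of_mem (by exact hv)]

/-! ### The optimal mechanism in a single round -/

/-- The score of the winning set `W`, when `d W` is its continuation value. -/
def Model.score (M : Model n k) (c : ℝ) (d : Finset (Fin n) → ℝ) (v : Fin n → ℝ)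
    (W : Finset (Fin n)) : EReal :=
  (c : EReal) * ∑ i ∈ W, (M.dist i).virtualValue (v i) + (d W : EReal)

/-- The score as a real number, meaningful where the virtual values are finite. -/
def Model.realScore (M : Model n k) (c : ℝ) (d : Finset (Fin n) → ℝ) (v : Fin n → ℝ)
    (W : Finset (Fin n)) : ℝ :=
  c * ∑ i ∈ W, (M.dist i).realVirtual (v i) + d W

/-- The rule of allocation, for an arbitrary score `e` of the winning sets. -/
def Obeys (k : ℕ) (e : Finset (Fin n) → EReal) (W : Finset (Fin n)) : Prop :=
  ((0 < W.card ∧ W.card ≤ k ∧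
    ∀ W' : Finset (Fin n), 0 < W'.card → W'.card ≤ k → e W' ≤ e W) ∧ 0 < e W) ∨
    (W = ∅ ∧ ∀ W' : Finset (Fin n), 0 < W'.card → W'.card ≤ k → e W' ≤ 0)

/-- For c = 0 no finiteness is required, since 0 · (-∞) = 0 in `EReal`. -/
lemma Model.score_eq_coe (M : Model n k) {c : ℝ} (d : Finset (Fin n) → ℝ) {v : Fin n → ℝ}
    {W : Finset (Fin n)} (h : c = 0 ∨ ∀ i ∈ W, (M.dist i).invHazard (v i) ≠ ∞) :
    M.score c d v W = (M.realScore c d v W : EReal) := by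
  rw [Model.score, Model.realScore, EReal.coe_add, EReal.coe_mul]
  rcases h with rfl | h
  · simp
  · congr 2
    rw [Finset.sum_congr rfl fun i hi => (M.dist i).virtualValue_eq_coe (h i hi)]
    induction W using Finset.cons_induction with
    | empty => simp
    | cons i W hi ih =>
      rw [Finset.sum_cons, Finset.sum_cons, EReal.coe_add,
        ih fun j hj => h j (Finset.mem_cons_of_mem hj)]

lemma Model.score_eq_bot (M : Model n k) {c : ℝ} (hc : 0 < c) (d : Finset (Fin n) → ℝ)
    {v : Fin n → ℝ} {W : Finset (Fin n)} {i : Fin n} (hi : i ∈ W)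
    (h : (M.dist i).invHazard (v i) = ∞) : M.score c d v W = ⊥ := by
  rw [Model.score, ← Finset.add_sum_erase W _ hi, (M.dist i).virtualValue_eq_bot h,
    EReal.bot_add, EReal.coe_mul_bot_of_pos hc, EReal.bot_add]

lemma Model.realScore_empty (M : Model n k) (c : ℝ) {d : Finset (Fin n) → ℝ} (hd : d ∅ = 0)
    (v : Fin n → ℝ) : M.realScore c d v ∅ = 0 := by
  simp [Model.realScore, hd]

lemma admissible_nonempty (n k : ℕ) :
    (Finset.univ.filter fun W : Finset (Fin n) => W.card ≤ k).Nonempty :=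
  ⟨∅, by simp⟩

/-- The largest score of an admissible set, including the empty one. -/
def Model.bestScore (M : Model n k) (c : ℝ) (d : Finset (Fin n) → ℝ) (v : Fin n → ℝ) : ℝ :=
  (Finset.univ.filter fun W : Finset (Fin n) => W.card ≤ k).sup' (admissible_nonempty n k)
    (M.realScore c d v)

lemma Model.realScore_le_bestScore (M : Model n k) (c : ℝ) (d : Finset (Fin n) → ℝ)
    (v : Fin n → ℝ) {W : Finset (Fin n)} (hW : W.card ≤ k) :
    M.realScore c d v W ≤ M.bestScore c d v :=
  Finset.le_sup' (M.realScore c d v) (Finset.mem_filter.2 ⟨Finset.mem_univ W, hW⟩)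

lemma Model.bestScore_nonneg (M : Model n k) (c : ℝ) {d : Finset (Fin n) → ℝ} (hd : d ∅ = 0)
    (v : Fin n → ℝ) : 0 ≤ M.bestScore c d v := by
  rw [← M.realScore_empty c hd v]
  exact M.realScore_le_bestScore c d v (by simp)

lemma Model.integrable_realScore (M : Model n k) (hmean : ∀ i, (M.dist i).FiniteMean) (c : ℝ)
    (d : Finset (Fin n) → ℝ) (W : Finset (Fin n)) :
    Integrable (fun v => M.realScore c d v W) M.valueLaw :=
  ((integrable_finsetSum W fun i _ => M.integrable_realVirtual hmean i).const_mul c).add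
    (integrable_const _)

lemma Model.measurable_realScore (M : Model n k) {d : State → Finset (Fin n) → ℝ}
    (hd : ∀ W, Measurable fun c => d c W) (W : Finset (Fin n)) :
    Measurable fun q : State × (Fin n → ℝ) => M.realScore q.1 (d q.1) q.2 W :=
  ((measurable_subtype_coe.comp measurable_fst).mul (Finset.measurable_sum W fun i _ =>
    (M.dist i).measurable_realVirtual.comp ((measurable_pi_apply i).comp measurable_snd))).add
    ((hd W).comp measurable_fst)

lemma Model.measurable_score (M : Model n k) {d : State → Finset (Fin n) → ℝ}
    (hd : ∀ W, Measurable fun c => d c W) (W : Finset (Fin n)) :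
    Measurable fun q : State × (Fin n → ℝ) => M.score q.1 (d q.1) q.2 W :=
  ((measurable_coe_real_ereal.comp (measurable_subtype_coe.comp measurable_fst)).mul
    (Finset.measurable_sum W fun i _ => (M.dist i).measurable_virtualValue.comp
      ((measurable_pi_apply i).comp measurable_snd))).add
    (measurable_coe_real_ereal.comp ((hd W).comp measurable_fst))

lemma Model.measurable_bestScore (M : Model n k) {d : State → Finset (Fin n) → ℝ}
    (hd : ∀ W, Measurable fun c => d c W) :
    Measurable fun q : State × (Fin n → ℝ) => M.bestScore q.1 (d q.1) q.2 := by
  have := Finset.measurable_sup' (admissible_nonempty n k)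
    (f := fun W (q : State × (Fin n → ℝ)) => M.realScore q.1 (d q.1) q.2 W)
    fun W _ => M.measurable_realScore hd W
  convert this using 2 with q
  simp [Model.bestScore, Finset.sup'_apply]

lemma Model.integrable_bestScore (M : Model n k) (hmean : ∀ i, (M.dist i).FiniteMean) (c : State)
    (d : Finset (Fin n) → ℝ) : Integrable (M.bestScore c d) M.valueLaw := by
  refine (integrable_finsetSum Finset.univ fun W _ =>
    (M.integrable_realScore hmean c d W).abs).mono' ?_ (Filter.Eventually.of_forall fun v => ?_)
  · exact ((M.measurable_bestScore (d := fun _ => d) fun _ => measurable_const).comp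
      (measurable_prodMk_left (x := c))).aestronglyMeasurable
  · obtain ⟨W, -, hW⟩ := Finset.exists_mem_eq_sup' (admissible_nonempty n k)
      (M.realScore c d v)
    rw [Model.bestScore, hW]
    exact Finset.single_le_sum (f := fun W => |M.realScore c d v W|)
      (fun _ _ => abs_nonneg _) (Finset.mem_univ W)

/-- The expected revenue plus the expected continuation value. -/
def Model.objective (M : Model n k) (a : Mechanism n k) (c : ℝ) (d : Finset (Fin n) → ℝ) : ℝ :=
  c * ∑ i, ∫ v, a.pay v i ∂M.valueLaw + ∑ W, d W * ∫ v, a.alloc v W ∂M.valueLaw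

/-- The average score of the winning set of a randomized allocation. -/
def Model.meanScore (M : Model n k) (a : Mechanism n k) (c : ℝ) (d : Finset (Fin n) → ℝ)
    (v : Fin n → ℝ) : ℝ :=
  ∑ W, a.alloc v W * M.realScore c d v W

lemma Model.meanScore_eq (M : Model n k) (a : Mechanism n k) (c : ℝ) (d : Finset (Fin n) → ℝ)
    (v : Fin n → ℝ) :
    M.meanScore a c d v = c * ∑ i, (M.dist i).realVirtual (v i) * marginal (a.alloc v) i +
      ∑ W, d W * a.alloc v W := by
  have h : ∑ i, (M.dist i).realVirtual (v i) * marginal (a.alloc v) i =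
      ∑ W, a.alloc v W * ∑ i ∈ W, (M.dist i).realVirtual (v i) := by
    simp only [marginal, Finset.mul_sum, Finset.sum_filter]
    rw [Finset.sum_comm]
    refine Finset.sum_congr rfl fun W _ => ?_
    simp only [mul_ite, mul_zero, Finset.sum_ite_mem, Finset.univ_inter]
    exact Finset.sum_congr rfl fun i _ => mul_comm _ _
  rw [h, Finset.mul_sum, ← Finset.sum_add_distrib]
  refine Finset.sum_congr rfl fun W _ => ?_
  rw [Model.realScore]
  ring

lemma Model.integral_meanScore (M : Model n k) (hmean : ∀ i, (M.dist i).FiniteMean)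
    (a : Mechanism n k) (c : ℝ) (d : Finset (Fin n) → ℝ) :
    Integrable (M.meanScore a c d) M.valueLaw ∧ ∫ v, M.meanScore a c d v ∂M.valueLaw =
      c * ∑ i, ∫ v, (M.dist i).realVirtual (v i) * marginal (a.alloc v) i ∂M.valueLaw +
        ∑ W, d W * ∫ v, a.alloc v W ∂M.valueLaw := by
  have h1 : ∀ i ∈ Finset.univ, Integrable
      (fun v => (M.dist i).realVirtual (v i) * marginal (a.alloc v) i) M.valueLaw :=
    fun i _ => M.integrable_mul_marginal a i (M.integrable_realVirtual hmean i)
  have h2 : ∀ W ∈ Finset.univ, Integrable (fun v => d W * a.alloc v W) M.valueLaw :=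
    fun W _ => (M.integrable_alloc a W).const_mul _
  have h3 := (integrable_finsetSum _ h1).const_mul c
  have h4 := integrable_finsetSum _ h2
  have e : M.meanScore a c d = fun v =>
      c * ∑ i, (M.dist i).realVirtual (v i) * marginal (a.alloc v) i +
        ∑ W, d W * a.alloc v W := funext (M.meanScore_eq a c d)
  rw [e]
  refine ⟨h3.add h4, ?_⟩
  rw [integral_add h3 h4, integral_const_mul, integral_finsetSum _ h1, integral_finsetSum _ h2]
  simp only [integral_const_mul]

lemma Model.objective_le_integral_meanScore (M : Model n k)
    (hmean : ∀ i, (M.dist i).FiniteMean) (a : Mechanism n k) {c : ℝ} (hc : 0 ≤ c)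
    (d : Finset (Fin n) → ℝ) :
    M.objective a c d ≤ ∫ v, M.meanScore a c d v ∂M.valueLaw := by
  rw [(M.integral_meanScore hmean a c d).2, Model.objective]
  exact add_le_add_left (mul_le_mul_of_nonneg_left
    (Finset.sum_le_sum fun i _ => M.integral_pay_le hmean a i) hc) _

/-- The allocation probabilities sum to 1. The regret is thereby a sum of nonnegative terms, so zero
regret forces every set chosen with positive probability to have maximal score. -/
lemma Model.bestScore_sub_meanScore (M : Model n k) (a : Mechanism n k) (c : ℝ)
    (d : Finset (Fin n) → ℝ) {v : Fin n → ℝ} (hv : 0 ≤ v) :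
    M.bestScore c d v - M.meanScore a c d v =
      ∑ W, a.alloc v W * (M.bestScore c d v - M.realScore c d v W) := by
  simp only [mul_sub, Finset.sum_sub_distrib, ← Finset.sum_mul, a.alloc_sum v hv, one_mul,
    Model.meanScore]

lemma Model.alloc_mul_sub_nonneg (M : Model n k) (a : Mechanism n k) (c : ℝ)
    (d : Finset (Fin n) → ℝ) {v : Fin n → ℝ} (hv : 0 ≤ v) (W : Finset (Fin n)) :
    0 ≤ a.alloc v W * (M.bestScore c d v - M.realScore c d v W) := by
  rcases le_or_gt W.card k with hW | hW
  · exact mul_nonneg (a.alloc_nonneg v hv W)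
      (sub_nonneg.2 (M.realScore_le_bestScore c d v hW))
  · rw [a.alloc_card v hv W hW, zero_mul]

lemma Model.meanScore_le_bestScore (M : Model n k) (a : Mechanism n k) (c : ℝ)
    (d : Finset (Fin n) → ℝ) {v : Fin n → ℝ} (hv : 0 ≤ v) :
    M.meanScore a c d v ≤ M.bestScore c d v := by
  rw [← sub_nonneg, M.bestScore_sub_meanScore a c d hv]
  exact Finset.sum_nonneg fun W _ => M.alloc_mul_sub_nonneg a c d hv W

lemma Model.integral_meanScore_le (M : Model n k) (hmean : ∀ i, (M.dist i).FiniteMean)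
    (a : Mechanism n k) (c : State) (d : Finset (Fin n) → ℝ) :
    ∫ v, M.meanScore a c d v ∂M.valueLaw ≤ ∫ v, M.bestScore c d v ∂M.valueLaw := by
  refine integral_mono_ae (M.integral_meanScore hmean a c d).1
    (M.integrable_bestScore hmean c d) ?_
  filter_upwards [M.ae_nonneg] with v hv using M.meanScore_le_bestScore a c d hv

lemma Model.objective_le (M : Model n k) (hmean : ∀ i, (M.dist i).FiniteMean)
    (a : Mechanism n k) (c : State) (d : Finset (Fin n) → ℝ) :
    M.objective a c d ≤ ∫ v, M.bestScore c d v ∂M.valueLaw :=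
  (M.objective_le_integral_meanScore hmean a c.2.1 d).trans (M.integral_meanScore_le hmean a c d)

/-- A mechanism attaining the maximum almost surely chooses sets of maximal score. -/
lemma Model.realScore_eq_of_objective_eq (M : Model n k) (hmean : ∀ i, (M.dist i).FiniteMean)
    (a : Mechanism n k) (c : State) (d : Finset (Fin n) → ℝ)
    (h : M.objective a c d = ∫ v, M.bestScore c d v ∂M.valueLaw) :
    ∀ᵐ v ∂M.valueLaw, ∀ W, 0 < a.alloc v W → M.realScore c d v W = M.bestScore c d v := by
  have hm := M.integral_meanScore hmean a c d
  have hb := M.integrable_bestScore hmean c d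
  have h0 : ∫ v, (M.bestScore c d v - M.meanScore a c d v) ∂M.valueLaw = 0 := by
    rw [integral_sub hb hm.1]
    have := M.objective_le_integral_meanScore hmean a c.2.1 d
    have := M.integral_meanScore_le hmean a c d
    linarith
  rw [integral_eq_zero_iff_of_nonneg_ae (f := fun v => M.bestScore c d v - M.meanScore a c d v)
    _ (hb.sub hm.1)] at h0
  · filter_upwards [h0, M.ae_nonneg] with v hv0 hv W hW
    rw [M.bestScore_sub_meanScore a c d hv, Pi.zero_apply, Finset.sum_eq_zero_iff_of_nonneg
      fun W _ => M.alloc_mul_sub_nonneg a c d hv W] at hv0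
    rcases mul_eq_zero.1 (hv0 W (Finset.mem_univ W)) with h | h
    · exact absurd h hW.ne'
    · linarith
  · filter_upwards [M.ae_nonneg] with v hv using
      sub_nonneg.2 (M.meanScore_le_bestScore a c d hv)

/-- Since the empty set scores 0, comparing the best nonempty set with 0 amounts to maximizing over
all admissible sets, the empty one included. -/
lemma Model.realScore_eq_of_obeys (M : Model n k) {c : ℝ} {d : Finset (Fin n) → ℝ}
    (hd : d ∅ = 0) {v : Fin n → ℝ} (hv : ∀ i, (M.dist i).invHazard (v i) ≠ ∞)
    {W : Finset (Fin n)} (hW : Obeys k (M.score c d v) W) :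
    M.realScore c d v W = M.bestScore c d v := by
  have hs : ∀ W, M.score c d v W = (M.realScore c d v W : EReal) :=
    fun W => M.score_eq_coe d (Or.inr fun i _ => hv i)
  simp only [Obeys, hs, EReal.coe_le_coe_iff, EReal.coe_pos] at hW
  have h0 := M.realScore_empty c hd v
  refine le_antisymm ?_ ?_
  · refine M.realScore_le_bestScore c d v ?_
    rcases hW with hW | hW
    · exact hW.1.2.1
    · simp [hW.1]
  · refine Finset.sup'_le _ _ fun W' hW' => ?_
    have hk := (Finset.mem_filter.1 hW').2
    rcases W'.eq_empty_or_nonempty with rfl | hne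
    · rcases hW with hW | hW
      · rw [h0]
        exact hW.2.le
      · rw [hW.1]
    · rcases hW with hW | hW
      · exact hW.1.2.2 W' hne.card_pos hk
      · rw [hW.1, h0]
        exact_mod_cast hW.2 W' hne.card_pos hk

/-- A mechanism that obeys the rule attains the maximum. -/
lemma Model.objective_eq_of_obeys (M : Model n k) (hmean : ∀ i, (M.dist i).FiniteMean)
    (a : Mechanism n k) (c : State) {d : Finset (Fin n) → ℝ} (hd : d ∅ = 0)
    (h : ∀ v, 0 ≤ v → ∀ W, 0 < a.alloc v W → Obeys k (M.score c d v) W) :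
    M.objective a c d = ∫ v, M.bestScore c d v ∂M.valueLaw := by
  have e1 : M.objective a c d = ∫ v, M.meanScore a c d v ∂M.valueLaw := by
    rw [(M.integral_meanScore hmean a c d).2, Model.objective]
    congr 1
    -- At c = 0 the rule may let a bidder of virtual value -∞ win, and then the payment identity can
    -- fail; but revenue has weight 0 there. For c > 0 such a winner would make the score of W equal
    -- to -∞, contradicting its positivity.
    rcases c.2.1.eq_or_lt with hc | hc
    · rw [← hc, zero_mul, zero_mul]
    · congr 1
      refine Finset.sum_congr rfl fun i _ => M.integral_pay hmean a i fun v hv hH => ?_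
      refine Finset.sum_eq_zero fun W hW => ?_
      have hi := (Finset.mem_filter.1 hW).2
      by_contra hne
      rcases h v hv W (lt_of_le_of_ne (a.alloc_nonneg v hv W) (Ne.symm hne)) with h | h
      · have := h.2
        rw [M.score_eq_bot hc d hi hH] at this
        exact absurd this not_lt_bot
      · rw [h.1] at hi
        simp at hi
  rw [e1]
  refine integral_congr_ae ?_
  filter_upwards [M.ae_nonneg, M.ae_invHazard_ne_top] with v hv hH
  rw [eq_comm, ← sub_eq_zero, M.bestScore_sub_meanScore a c d hv]
  refine Finset.sum_eq_zero fun W _ => ?_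
  rcases (a.alloc_nonneg v hv W).eq_or_lt with h0 | h0
  · rw [← h0, zero_mul]
  · rw [M.realScore_eq_of_obeys hd hH (h v hv W h0), sub_self, mul_zero]

/-! ### The greedy mechanism -/

/-- An injective priority on the winning sets, used to break ties; the empty set comes first. -/
def priority (W : Finset (Fin n)) : ℕ := if W = ∅ then 0 else Encodable.encode W + 1

lemma priority_injective : Function.Injective (priority (n := n)) := by
  intro W W' h
  unfold priority at h
  split_ifs at h with h1 h2 h2
  · rw [h1, h2]
  · exact Encodable.encode_injective (by omega)

/-- `W` has the largest score among the admissible sets, and the least priority number among the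
admissible sets of this score. -/
def IsGreedy (k : ℕ) (e : Finset (Fin n) → EReal) (W : Finset (Fin n)) : Prop :=
  W.card ≤ k ∧ ∀ W' : Finset (Fin n), W'.card ≤ k →
    e W' < e W ∨ (e W' = e W ∧ priority W ≤ priority W')

lemma exists_isGreedy (k : ℕ) (e : Finset (Fin n) → EReal) : ∃ W, IsGreedy k e W := by
  classical
  obtain ⟨W₁, h₁, hmax⟩ := Finset.exists_max_image
    (Finset.univ.filter fun W : Finset (Fin n) => W.card ≤ k) e (admissible_nonempty n k)
  obtain ⟨W₂, h₂, hmin⟩ := Finset.exists_min_image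
    (Finset.univ.filter fun W : Finset (Fin n) => W.card ≤ k ∧ e W = e W₁) priority
    ⟨W₁, by simpa using h₁⟩
  simp only [Finset.mem_filter, Finset.mem_univ, true_and] at h₁ h₂ hmax hmin
  refine ⟨W₂, h₂.1, fun W' hW' => ?_⟩
  rw [h₂.2]
  rcases (hmax W' hW').lt_or_eq with h | h
  · exact Or.inl h
  · exact Or.inr ⟨h, hmin W' ⟨hW', h⟩⟩

lemma IsGreedy.le {e : Finset (Fin n) → EReal} {W W' : Finset (Fin n)}
    (h : IsGreedy k e W) (h' : W'.card ≤ k) : e W' ≤ e W := by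
  rcases h.2 W' h' with h | h
  · exact h.le
  · exact h.1.le

lemma IsGreedy.priority_le {e : Finset (Fin n) → EReal} {W W' : Finset (Fin n)}
    (h : IsGreedy k e W) (h' : W'.card ≤ k) (he : e W' = e W) : priority W ≤ priority W' := by
  rcases h.2 W' h' with h | h
  · exact absurd he h.ne
  · exact h.2

lemma IsGreedy.eq {e : Finset (Fin n) → EReal} {W W' : Finset (Fin n)}
    (h : IsGreedy k e W) (h' : IsGreedy k e W') : W = W' := by
  have he : e W' = e W := le_antisymm (h.le h'.1) (h'.le h.1)
  exact priority_injective (le_antisymm (h.priority_le h'.1 he) (h'.priority_le h.1 he.symm))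

/-- A winner keeps winning if the scores of the sets containing it increase. -/
lemma IsGreedy.mem_of_le {e e' : Finset (Fin n) → EReal} {W W' : Finset (Fin n)} {i : Fin n}
    (h : IsGreedy k e W) (h' : IsGreedy k e' W') (hin : ∀ U, i ∈ U → e U ≤ e' U)
    (hout : ∀ U, i ∉ U → e' U = e U) (hi : i ∈ W) : i ∈ W' := by
  by_contra hi'
  -- If i lost under e', then W and W' would tie for both scores: the sets without i keep their
  -- score and W can only gain. The fixed priority would then rank each of them no later than the
  -- other.
  have h1 : e' W' = e W' := hout W' hi'
  have h2 : e W' ≤ e W := h.le h'.1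
  have h3 : e W ≤ e' W := hin W hi
  have h4 : e' W ≤ e' W' := h'.le h.1
  have h5 : e W' = e W := le_antisymm h2 (h3.trans (h4.trans h1.le))
  have h6 : e' W = e' W' := le_antisymm h4 (by rw [h1, h5]; exact h3)
  have : W = W' := priority_injective
    (le_antisymm (h.priority_le h'.1 h5) (h'.priority_le h.1 h6))
  exact hi' (this ▸ hi)

lemma IsGreedy.obeys {e : Finset (Fin n) → EReal} (he : e ∅ = 0) {W : Finset (Fin n)}
    (h : IsGreedy k e W) : Obeys k e W := by
  have h0 : e ∅ ≤ e W := h.le (by simp)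
  rcases W.eq_empty_or_nonempty with rfl | hne
  · exact Or.inr ⟨rfl, fun W' _ h' => he ▸ h.le h'⟩
  · refine Or.inl ⟨⟨hne.card_pos, h.1, fun W' _ h' => h.le h'⟩, ?_⟩
    rw [he] at h0
    refine lt_of_le_of_ne h0 fun h1 => ?_
    -- A nonempty set of score 0 would tie with the empty set, which has priority 0 and would have
    -- been chosen.
    have := h.priority_le (W' := ∅) (by simp) (by rw [he, h1])
    simp [priority, hne.ne_empty] at this

/-- This is where regularity enters: it makes the greedy allocation monotone, hence implementable by
truthful payments. -/
lemma Model.score_mono_update (M : Model n k) (hreg : ∀ i, (M.dist i).Regular) {c : ℝ}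
    (hc : 0 ≤ c) (d : Finset (Fin n) → ℝ) (v : Fin n → ℝ) (i : Fin n) {y z : ℝ} (hy : 0 ≤ y)
    (hyz : y ≤ z) (W : Finset (Fin n)) :
    M.score c d (Function.update v i y) W ≤ M.score c d (Function.update v i z) W := by
  refine add_le_add_left (mul_le_mul_of_nonneg_left (Finset.sum_le_sum fun j _ => ?_)
    (EReal.coe_nonneg.2 hc)) _
  by_cases h : j = i
  · subst h
    simpa using hreg j hy (hy.trans hyz) hyz
  · simp [h]

lemma Model.score_update_of_notMem (M : Model n k) (c : ℝ) (d : Finset (Fin n) → ℝ)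
    (v : Fin n → ℝ) {i : Fin n} (y : ℝ) {W : Finset (Fin n)} (hi : i ∉ W) :
    M.score c d (Function.update v i y) W = M.score c d v W := by
  simp only [Model.score]
  congr 2
  refine Finset.sum_congr rfl fun j hj => ?_
  rw [Function.update_of_ne (ne_of_mem_of_not_mem hj hi)]

open Classical in
/-- The deterministic choice of the greedy winning set. -/
def Model.greedyAlloc (M : Model n k) (c : ℝ) (d : Finset (Fin n) → ℝ) (v : Fin n → ℝ)
    (W : Finset (Fin n)) : ℝ :=
  if IsGreedy k (M.score c d v) W then 1 else 0

lemma Model.greedyAlloc_nonneg (M : Model n k) (c : ℝ) (d : Finset (Fin n) → ℝ)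
    (v : Fin n → ℝ) (W : Finset (Fin n)) : 0 ≤ M.greedyAlloc c d v W := by
  unfold Model.greedyAlloc
  split_ifs <;> norm_num

lemma Model.greedyAlloc_eq (M : Model n k) {c : ℝ} {d : Finset (Fin n) → ℝ} {v : Fin n → ℝ}
    {W : Finset (Fin n)} (h : IsGreedy k (M.score c d v) W) (W' : Finset (Fin n)) :
    M.greedyAlloc c d v W' = if W' = W then 1 else 0 := by
  classical
  rw [Model.greedyAlloc, if_congr ⟨fun h' => h'.eq h, fun h' => h' ▸ h⟩ rfl rfl]

lemma Model.greedyAlloc_sum (M : Model n k) (c : ℝ) (d : Finset (Fin n) → ℝ)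
    (v : Fin n → ℝ) : ∑ W, M.greedyAlloc c d v W = 1 := by
  obtain ⟨W, hW⟩ := exists_isGreedy k (M.score c d v)
  simp [M.greedyAlloc_eq hW]

lemma Model.marginal_greedyAlloc (M : Model n k) {c : ℝ} {d : Finset (Fin n) → ℝ}
    {v : Fin n → ℝ} {W : Finset (Fin n)} (h : IsGreedy k (M.score c d v) W) (i : Fin n) :
    marginal (M.greedyAlloc c d v) i = if i ∈ W then 1 else 0 := by
  simp [marginal, M.greedyAlloc_eq h]

lemma Model.monotoneOn_marginal_greedyAlloc (M : Model n k) (hreg : ∀ i, (M.dist i).Regular)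
    {c : ℝ} (hc : 0 ≤ c) (d : Finset (Fin n) → ℝ) (v : Fin n → ℝ) (i : Fin n) :
    MonotoneOn (fun z => marginal (M.greedyAlloc c d (Function.update v i z)) i)
      (Set.Ici 0) := by
  intro y hy z _ hyz
  obtain ⟨W, hW⟩ := exists_isGreedy k (M.score c d (Function.update v i y))
  obtain ⟨W', hW'⟩ := exists_isGreedy k (M.score c d (Function.update v i z))
  simp only [M.marginal_greedyAlloc hW, M.marginal_greedyAlloc hW']
  by_cases hi : i ∈ W
  · have : i ∈ W' := hW.mem_of_le hW'
      (fun U _ => M.score_mono_update hreg hc d v i hy hyz U)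
      (fun U hU => by rw [M.score_update_of_notMem c d v z hU,
        M.score_update_of_notMem c d v y hU]) hi
    simp [hi, this]
  · rw [if_neg hi]
    split_ifs <;> norm_num

lemma Model.measurable_greedyAlloc (M : Model n k) {d : State → Finset (Fin n) → ℝ}
    (hd : ∀ W, Measurable fun c => d c W) (W : Finset (Fin n)) :
    Measurable fun q : State × (Fin n → ℝ) => M.greedyAlloc q.1 (d q.1) q.2 W := by
  classical
  refine Measurable.ite ?_ measurable_const measurable_const
  have hs := fun W => M.measurable_score hd W
  have : {q : State × (Fin n → ℝ) | IsGreedy k (M.score q.1 (d q.1) q.2) W} =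
      {_q | W.card ≤ k} ∩ ⋂ W' : Finset (Fin n), {q | W'.card ≤ k →
        (M.score q.1 (d q.1) q.2 W' < M.score q.1 (d q.1) q.2 W ∨
        (M.score q.1 (d q.1) q.2 W' = M.score q.1 (d q.1) q.2 W ∧
          priority W ≤ priority W'))} := by
    ext q
    simp [IsGreedy]
  rw [this]
  refine (MeasurableSet.const _).inter (MeasurableSet.iInter fun W' => ?_)
  by_cases h : W'.card ≤ k
  · simp only [h, true_imp_iff]
    exact (measurableSet_lt (hs W') (hs W)).union
      ((measurableSet_eq_fun (hs W') (hs W)).inter (MeasurableSet.const _))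
  · simp [h]

/-- The payments that make a monotone allocation rule truthful. -/
def envelopePay (x : (Fin n → ℝ) → Finset (Fin n) → ℝ) (v : Fin n → ℝ) (i : Fin n) : ℝ :=
  v i * marginal (x v) i - ∫ z in Set.Ioc 0 (v i), marginal (x (Function.update v i z)) i

lemma measurable_envelopePay {x : State → (Fin n → ℝ) → Finset (Fin n) → ℝ}
    (hx : ∀ W, Measurable fun q : State × (Fin n → ℝ) => x q.1 q.2 W) (i : Fin n) :
    Measurable fun q : State × (Fin n → ℝ) => envelopePay (x q.1) q.2 i := by
  have hm : Measurable fun q : State × (Fin n → ℝ) => marginal (x q.1 q.2) i :=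
    Finset.measurable_sum _ fun W _ => hx W
  have hv : Measurable fun q : State × (Fin n → ℝ) => q.2 i :=
    (measurable_pi_apply i).comp measurable_snd
  refine (hv.mul hm).sub ?_
  have hS : MeasurableSet {p : (State × (Fin n → ℝ)) × ℝ | 0 < p.2 ∧ p.2 ≤ p.1.2 i} :=
    (measurableSet_lt measurable_const measurable_snd).inter
      (measurableSet_le measurable_snd (hv.comp measurable_fst))
  have hu : Measurable fun p : (State × (Fin n → ℝ)) × ℝ =>
      (p.1.1, Function.update p.1.2 i p.2) :=
    (measurable_fst.comp measurable_fst).prodMk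
      ((measurable_update_prod i).comp
        ((measurable_snd.comp measurable_fst).prodMk measurable_snd))
  have h := (((hm.comp hu).indicator hS).stronglyMeasurable.integral_prod_right'
    (ν := (volume : Measure ℝ))).measurable
  convert h using 2 with q
  rw [← integral_indicator measurableSet_Ioc]
  rfl

/-- The integral of a monotone function has q b as a subgradient at b: compare the area between b
and x with a rectangle of height q b. For the envelope payments this is truthfulness, and at x = 0
nonnegativity of the payment. -/
lemma integral_add_sub_mul_le_of_monotoneOn {q : ℝ → ℝ} (hq : MonotoneOn q (Set.Ici 0))
    {x b : ℝ} (hx : 0 ≤ x) (hb : 0 ≤ b) :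
    (∫ z in Set.Ioc 0 b, q z) + (x - b) * q b ≤ ∫ z in Set.Ioc 0 x, q z := by
  have hint : ∀ a b, 0 ≤ a → 0 ≤ b → IntervalIntegrable q volume a b := fun a b ha hb =>
    (hq.mono fun z hz => (le_min ha hb).trans hz.1).intervalIntegrable
  rw [← intervalIntegral.integral_of_le hx, ← intervalIntegral.integral_of_le hb]
  rcases le_total b x with h | h
  · have h1 := intervalIntegral.integral_mono_on h (by simp) (hint b x hb hx)
      (f := fun _ => q b) (fun z hz => hq hb (hb.trans hz.1) hz.1)
    have h2 := intervalIntegral.integral_add_adjacent_intervals (hint 0 b le_rfl hb)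
      (hint b x hb hx)
    simp at h1
    linarith
  · have h1 := intervalIntegral.integral_mono_on h (hint x b hx hb) (by simp)
      (g := fun _ => q b) (fun z hz => hq (hx.trans hz.1) hb hz.2)
    have h2 := intervalIntegral.integral_add_adjacent_intervals (hint 0 x le_rfl hx)
      (hint x b hx hb)
    simp at h1
    linarith

/-- A monotone allocation rule with the corresponding payments. -/
def Mechanism.ofMonotone (x : (Fin n → ℝ) → Finset (Fin n) → ℝ)
    (hx : ∀ W, Measurable fun v => x v W) (hp : ∀ i, Measurable fun v => envelopePay x v i)
    (hnn : ∀ v W, 0 ≤ x v W) (hsum : ∀ v, ∑ W, x v W = 1)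
    (hcard : ∀ v (W : Finset (Fin n)), k < W.card → x v W = 0)
    (hmono : ∀ v i, MonotoneOn (fun z => marginal (x (Function.update v i z)) i) (Set.Ici 0)) :
    Mechanism n k where
  alloc := x
  pay := envelopePay x
  measurable_alloc := hx
  measurable_pay := hp
  alloc_nonneg v _ := hnn v
  alloc_sum v _ := hsum v
  alloc_card v _ := hcard v
  pay_nonneg v hv i := by
    have := integral_add_sub_mul_le_of_monotoneOn (hmono v i) le_rfl (hv i)
    simp only [Set.Ioc_self, Measure.restrict_empty, integral_zero_measure,
      Function.update_eq_self] at this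
    unfold envelopePay
    linarith
  rational v hv i := by
    unfold envelopePay
    rw [sub_sub_cancel]
    exact setIntegral_nonneg measurableSet_Ioc fun z _ => Finset.sum_nonneg fun W _ => hnn _ W
  truthful v hv i b hb := by
    have := integral_add_sub_mul_le_of_monotoneOn (hmono v i) (hv i) hb
    simp only [envelopePay, Function.update_self, Function.update_idem]
    linarith

/-- The policy that uses the greedy mechanism in every state. -/
def Model.greedyPolicy (M : Model n k) (hreg : ∀ i, (M.dist i).Regular)
    {d : State → Finset (Fin n) → ℝ} (hd : ∀ W, Measurable fun c => d c W) : Policy n k where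
  mech c := Mechanism.ofMonotone (M.greedyAlloc c (d c))
    (fun W => (M.measurable_greedyAlloc hd W).comp measurable_prodMk_left)
    (fun i => (measurable_envelopePay (x := fun c => M.greedyAlloc c (d c))
      (M.measurable_greedyAlloc hd) i).comp measurable_prodMk_left)
    (M.greedyAlloc_nonneg c (d c)) (M.greedyAlloc_sum c (d c))
    (fun _ _ hW => if_neg fun h => absurd h.1 (not_le.2 hW))
    (M.monotoneOn_marginal_greedyAlloc hreg c.2.1 (d c))
  measurable_alloc := M.measurable_greedyAlloc hd
  measurable_pay := measurable_envelopePay (x := fun c => M.greedyAlloc c (d c))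
    (M.measurable_greedyAlloc hd)

lemma Model.greedyPolicy_alloc (M : Model n k) (hreg : ∀ i, (M.dist i).Regular)
    {d : State → Finset (Fin n) → ℝ} (hd : ∀ W, Measurable fun c => d c W)
    (h0 : ∀ c, d c ∅ = 0) (c : State) (v : Fin n → ℝ) :
    ∃ W, Obeys k (M.score c (d c) v) W ∧
      ∀ W', ((M.greedyPolicy hreg hd).mech c).alloc v W' = if W' = W then 1 else 0 := by
  obtain ⟨W, hW⟩ := exists_isGreedy k (M.score c (d c) v)
  refine ⟨W, hW.obeys ?_, M.greedyAlloc_eq hW⟩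
  simp [Model.score, h0]

lemma Model.greedyPolicy_obeys (M : Model n k) (hreg : ∀ i, (M.dist i).Regular)
    {d : State → Finset (Fin n) → ℝ} (hd : ∀ W, Measurable fun c => d c W)
    (h0 : ∀ c, d c ∅ = 0) (c : State) (v : Fin n → ℝ) (W : Finset (Fin n))
    (hW : 0 < ((M.greedyPolicy hreg hd).mech c).alloc v W) : Obeys k (M.score c (d c) v) W := by
  obtain ⟨W', h1, h2⟩ := M.greedyPolicy_alloc hreg hd h0 c v
  rw [h2] at hW
  split_ifs at hW with h3
  · exact h3 ▸ h1
  · exact absurd hW (lt_irrefl _)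

/-! ### The Bellman operator -/

instance (M : Model n k) (W : Finset (Fin n)) : IsMarkovKernel (M.trans W) := M.markov W

/-- The value of using the mechanism `a` in state `c`, if `h` is the value of the next state. -/
def Model.lookahead (M : Model n k) (h : State → ℝ≥0∞) (a : Mechanism n k) (c : State) : ℝ≥0∞ :=
  M.reward a c + ENNReal.ofReal M.γ * ∑ W, M.winProb a W * ∫⁻ s, h s ∂M.trans W c

/-- The Bellman operator. -/
def Model.bellman (M : Model n k) (h : State → ℝ≥0∞) (c : State) : ℝ≥0∞ :=
  ⨆ a : Mechanism n k, M.lookahead h a c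

/-- The discounted gain in continuation value from showing `W` instead of nothing. -/
def Model.gain (M : Model n k) (h : State → ℝ≥0∞) (c : State) (W : Finset (Fin n)) : ℝ :=
  M.γ * ((∫⁻ s, h s ∂M.trans W c).toReal - (∫⁻ s, h s ∂M.trans ∅ c).toReal)

lemma Model.gain_empty (M : Model n k) (h : State → ℝ≥0∞) (c : State) : M.gain h c ∅ = 0 := by
  simp [Model.gain]

lemma Model.measurable_gain (M : Model n k) {h : State → ℝ≥0∞} (hh : Measurable h)
    (W : Finset (Fin n)) : Measurable fun c => M.gain h c W :=
  ((hh.lintegral_kernel (κ := M.trans W)).ennreal_toReal.sub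
    (hh.lintegral_kernel (κ := M.trans ∅)).ennreal_toReal).const_mul _

lemma Model.reward_eq (M : Model n k) (hmean : ∀ i, (M.dist i).FiniteMean) (a : Mechanism n k)
    (c : State) :
    M.reward a c = ENNReal.ofReal ((c : ℝ) * ∑ i, ∫ v, a.pay v i ∂M.valueLaw) := by
  have hnn : ∀ i, 0 ≤ᵐ[M.valueLaw] fun v => a.pay v i := fun i => by
    filter_upwards [M.ae_nonneg] with v hv using a.pay_nonneg v hv i
  rw [Model.reward, lintegral_finsetSum _ fun i _ => (a.measurable_pay i).ennreal_ofReal,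
    ENNReal.ofReal_mul c.2.1, ENNReal.ofReal_sum_of_nonneg
      fun i _ => integral_nonneg_of_ae (hnn i)]
  congr 1
  exact Finset.sum_congr rfl fun i _ =>
    (ofReal_integral_eq_lintegral_ofReal (M.integrable_pay hmean a i) (hnn i)).symm

lemma Model.ae_alloc_nonneg (M : Model n k) (a : Mechanism n k) (W : Finset (Fin n)) :
    0 ≤ᵐ[M.valueLaw] fun v => a.alloc v W := by
  filter_upwards [M.ae_nonneg] with v hv using a.alloc_nonneg v hv W

lemma Model.winProb_eq (M : Model n k) (a : Mechanism n k) (W : Finset (Fin n)) :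
    M.winProb a W = ENNReal.ofReal (∫ v, a.alloc v W ∂M.valueLaw) :=
  (ofReal_integral_eq_lintegral_ofReal (M.integrable_alloc a W) (M.ae_alloc_nonneg a W)).symm

lemma Model.sum_integral_alloc (M : Model n k) (a : Mechanism n k) :
    ∑ W, ∫ v, a.alloc v W ∂M.valueLaw = 1 := by
  rw [← integral_finsetSum _ fun W _ => M.integrable_alloc a W]
  have : (fun v => ∑ W, a.alloc v W) =ᵐ[M.valueLaw] fun _ => (1 : ℝ) := by
    filter_upwards [M.ae_nonneg] with v hv using a.alloc_sum v hv
  rw [integral_congr_ae this]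
  simp

lemma Model.sum_winProb (M : Model n k) (a : Mechanism n k) : ∑ W, M.winProb a W = 1 := by
  simp only [M.winProb_eq]
  rw [← ENNReal.ofReal_sum_of_nonneg fun W _ => integral_nonneg_of_ae (M.ae_alloc_nonneg a W),
    M.sum_integral_alloc, ENNReal.ofReal_one]

lemma lintegral_le_of_le {α : Type*} [MeasurableSpace α] {μ : Measure α} [IsProbabilityMeasure μ]
    {h : α → ℝ≥0∞} {B : ℝ≥0∞} (hB : ∀ s, h s ≤ B) : ∫⁻ s, h s ∂μ ≤ B := by
  calc ∫⁻ s, h s ∂μ ≤ ∫⁻ _, B ∂μ := lintegral_mono hB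
    _ = B := by simp

lemma lintegral_ne_top_of_le {α : Type*} [MeasurableSpace α] {μ : Measure α}
    [IsProbabilityMeasure μ] {h : α → ℝ≥0∞} {B : ℝ} (hB : ∀ s, h s ≤ ENNReal.ofReal B) :
    ∫⁻ s, h s ∂μ ≠ ∞ :=
  ((lintegral_le_of_le hB).trans_lt ENNReal.ofReal_lt_top).ne

/-- Because the win probabilities sum to 1, the continuation value of showing nothing can be split
off. What remains is a one-round objective whose continuation term vanishes at the empty set. -/
lemma Model.lookahead_eq (M : Model n k) (hmean : ∀ i, (M.dist i).FiniteMean)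
    {h : State → ℝ≥0∞} {B : ℝ} (hB : ∀ s, h s ≤ ENNReal.ofReal B) (a : Mechanism n k)
    (c : State) :
    0 ≤ M.γ * (∫⁻ s, h s ∂M.trans ∅ c).toReal + M.objective a c (M.gain h c) ∧
    M.lookahead h a c = ENNReal.ofReal
      (M.γ * (∫⁻ s, h s ∂M.trans ∅ c).toReal + M.objective a c (M.gain h c)) := by
  have hw : ∀ W, 0 ≤ ∫ v, a.alloc v W ∂M.valueLaw :=
    fun W => integral_nonneg_of_ae (M.ae_alloc_nonneg a W)
  have hp : 0 ≤ (c : ℝ) * ∑ i, ∫ v, a.pay v i ∂M.valueLaw := by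
    refine mul_nonneg c.2.1 (Finset.sum_nonneg fun i _ => integral_nonneg_of_ae ?_)
    filter_upwards [M.ae_nonneg] with v hv using a.pay_nonneg v hv i
  have hs : 0 ≤ ∑ W, (∫ v, a.alloc v W ∂M.valueLaw) * (∫⁻ s, h s ∂M.trans W c).toReal :=
    Finset.sum_nonneg fun W _ => mul_nonneg (hw W) ENNReal.toReal_nonneg
  have e : M.γ * (∫⁻ s, h s ∂M.trans ∅ c).toReal + M.objective a c (M.gain h c) =
      (c : ℝ) * ∑ i, ∫ v, a.pay v i ∂M.valueLaw +
      M.γ * ∑ W, (∫ v, a.alloc v W ∂M.valueLaw) * (∫⁻ s, h s ∂M.trans W c).toReal := by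
    have h1 : ∑ W, M.gain h c W * ∫ v, a.alloc v W ∂M.valueLaw =
        M.γ * ∑ W, (∫ v, a.alloc v W ∂M.valueLaw) * (∫⁻ s, h s ∂M.trans W c).toReal -
        M.γ * (∫⁻ s, h s ∂M.trans ∅ c).toReal * ∑ W, ∫ v, a.alloc v W ∂M.valueLaw := by
      rw [Finset.mul_sum, Finset.mul_sum, ← Finset.sum_sub_distrib]
      refine Finset.sum_congr rfl fun W _ => ?_
      rw [Model.gain]
      ring
    rw [Model.objective, h1, M.sum_integral_alloc]
    ring
  have hγ := M.γ_nonneg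
  rw [e]
  refine ⟨by positivity, ?_⟩
  rw [ENNReal.ofReal_add hp (mul_nonneg hγ hs), ENNReal.ofReal_mul hγ,
    ENNReal.ofReal_sum_of_nonneg fun W _ => mul_nonneg (hw W) ENNReal.toReal_nonneg,
    ← M.reward_eq hmean, Model.lookahead]
  congr 2
  refine Finset.sum_congr rfl fun W _ => ?_
  rw [ENNReal.ofReal_mul (hw W), ← M.winProb_eq, ENNReal.ofReal_toReal (lintegral_ne_top_of_le hB)]

/-- The maximal value of `lookahead`. -/
def Model.bestLookahead (M : Model n k) (h : State → ℝ≥0∞) (c : State) : ℝ :=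
  M.γ * (∫⁻ s, h s ∂M.trans ∅ c).toReal + ∫ v, M.bestScore c (M.gain h c) v ∂M.valueLaw

lemma Model.measurable_bestLookahead (M : Model n k) {h : State → ℝ≥0∞} (hh : Measurable h) :
    Measurable (M.bestLookahead h) :=
  ((hh.lintegral_kernel (κ := M.trans ∅)).ennreal_toReal.const_mul _).add
    (M.measurable_bestScore (M.measurable_gain hh)).stronglyMeasurable.integral_prod_right'.measurable

lemma Model.lookahead_eq_of_obeys (M : Model n k) (hmean : ∀ i, (M.dist i).FiniteMean)
    {h : State → ℝ≥0∞} {B : ℝ} (hB : ∀ s, h s ≤ ENNReal.ofReal B) (a : Mechanism n k) (c : State)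
    (ha : ∀ v, 0 ≤ v → ∀ W, 0 < a.alloc v W → Obeys k (M.score c (M.gain h c) v) W) :
    M.lookahead h a c = ENNReal.ofReal (M.bestLookahead h c) := by
  rw [(M.lookahead_eq hmean hB a c).2,
    M.objective_eq_of_obeys hmean a c (M.gain_empty h c) ha, Model.bestLookahead]

lemma Model.lookahead_le (M : Model n k) (hmean : ∀ i, (M.dist i).FiniteMean)
    {h : State → ℝ≥0∞} {B : ℝ} (hB : ∀ s, h s ≤ ENNReal.ofReal B) (a : Mechanism n k)
    (c : State) : M.lookahead h a c ≤ ENNReal.ofReal (M.bestLookahead h c) := by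
  rw [(M.lookahead_eq hmean hB a c).2, Model.bestLookahead]
  exact ENNReal.ofReal_le_ofReal (add_le_add_right (M.objective_le hmean a c _) _)

/-- The greedy mechanism attains the upper bound. The supremum over the large family of mechanisms
thus becomes an explicit integral, which makes the value iterates measurable. -/
lemma Model.bellman_eq (M : Model n k) (hreg : ∀ i, (M.dist i).Regular)
    (hmean : ∀ i, (M.dist i).FiniteMean) {h : State → ℝ≥0∞} (hh : Measurable h) {B : ℝ}
    (hB : ∀ s, h s ≤ ENNReal.ofReal B) (c : State) :
    M.bellman h c = ENNReal.ofReal (M.bestLookahead h c) := by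
  refine le_antisymm (iSup_le fun a => M.lookahead_le hmean hB a c) ?_
  rw [← M.lookahead_eq_of_obeys hmean hB ((M.greedyPolicy hreg (M.measurable_gain hh)).mech c) c]
  · exact le_iSup (fun a => M.lookahead h a c) _
  · exact fun v _ W hW => M.greedyPolicy_obeys hreg _ (M.gain_empty h) c v W hW

lemma Model.lookahead_mono (M : Model n k) {h h' : State → ℝ≥0∞} (hle : h ≤ h')
    (a : Mechanism n k) (c : State) : M.lookahead h a c ≤ M.lookahead h' a c := by
  unfold Model.lookahead
  gcongr with W _ s
  exact hle s

/-- An upper bound for the expected revenue of a round. -/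
def Model.meanTotal (M : Model n k) : ℝ := ∑ i, ∫ v, v i ∂M.valueLaw

lemma Model.meanTotal_nonneg (M : Model n k) : 0 ≤ M.meanTotal :=
  Finset.sum_nonneg fun i _ => integral_nonneg_of_ae <| by
    filter_upwards [M.ae_nonneg] with v hv using hv i

lemma Model.reward_le (M : Model n k) (hmean : ∀ i, (M.dist i).FiniteMean) (a : Mechanism n k)
    (c : State) : M.reward a c ≤ ENNReal.ofReal M.meanTotal := by
  rw [M.reward_eq hmean]
  have h1 : ∑ i, ∫ v, a.pay v i ∂M.valueLaw ≤ M.meanTotal :=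
    Finset.sum_le_sum fun i _ => by
      refine integral_mono_ae (M.integrable_pay hmean a i) (M.integrable_eval hmean i) ?_
      filter_upwards [M.ae_nonneg] with v hv using a.pay_le hv i
  refine ENNReal.ofReal_le_ofReal ?_
  calc (c : ℝ) * _ ≤ (c : ℝ) * M.meanTotal := mul_le_mul_of_nonneg_left h1 c.2.1
    _ ≤ 1 * M.meanTotal := mul_le_mul_of_nonneg_right c.2.2 M.meanTotal_nonneg
    _ = _ := one_mul _

/-- An upper bound for the discounted revenue. -/
def Model.valueBound (M : Model n k) : ℝ := M.meanTotal / (1 - M.γ)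

/-- The constant B = `valueBound` solves `meanTotal` + γ B = B. -/
lemma Model.bellman_le (M : Model n k) (hmean : ∀ i, (M.dist i).FiniteMean)
    {h : State → ℝ≥0∞} (hB : ∀ s, h s ≤ ENNReal.ofReal M.valueBound) (c : State) :
    M.bellman h c ≤ ENNReal.ofReal M.valueBound := by
  have hγ := M.γ_lt_one
  have hb : 0 ≤ M.valueBound := div_nonneg M.meanTotal_nonneg (by linarith)
  refine iSup_le fun a => ?_
  calc M.lookahead h a c ≤ ENNReal.ofReal M.meanTotal + ENNReal.ofReal M.γ *
        ∑ W, M.winProb a W * ENNReal.ofReal M.valueBound := by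
        unfold Model.lookahead
        gcongr with W
        · exact M.reward_le hmean a c
        · exact lintegral_le_of_le hB
    _ = ENNReal.ofReal (M.meanTotal + M.γ * M.valueBound) := by
        rw [← Finset.sum_mul, M.sum_winProb, one_mul,
          ENNReal.ofReal_add M.meanTotal_nonneg (mul_nonneg M.γ_nonneg hb),
          ENNReal.ofReal_mul M.γ_nonneg]
    _ = ENNReal.ofReal M.valueBound := by
        congr 1
        have : 1 - M.γ ≠ 0 := by linarith
        rw [Model.valueBound]
        field_simp
        ring

/-! ### Value iteration -/

/-- The optimal value of the auction repeated for `m` rounds. -/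
def Model.iterValue (M : Model n k) : ℕ → State → ℝ≥0∞
  | 0 => 0
  | m + 1 => M.bellman (M.iterValue m)

/-- The limit of value iteration. -/
def Model.limitValue (M : Model n k) (c : State) : ℝ≥0∞ := ⨆ m, M.iterValue m c

lemma Model.iterValue_monotone (M : Model n k) : Monotone M.iterValue := by
  refine monotone_nat_of_le_succ fun m => ?_
  induction m with
  | zero => exact fun c => zero_le
  | succ m ih => exact fun c => iSup_mono fun a => M.lookahead_mono ih a c

lemma Model.iterValue_le (M : Model n k) (hmean : ∀ i, (M.dist i).FiniteMean) (m : ℕ)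
    (c : State) : M.iterValue m c ≤ ENNReal.ofReal M.valueBound := by
  induction m generalizing c with
  | zero => exact zero_le
  | succ m ih => exact M.bellman_le hmean ih c

lemma Model.measurable_iterValue (M : Model n k) (hreg : ∀ i, (M.dist i).Regular)
    (hmean : ∀ i, (M.dist i).FiniteMean) (m : ℕ) : Measurable (M.iterValue m) := by
  induction m with
  | zero => exact measurable_const
  | succ m ih =>
    rw [show M.iterValue (m + 1) = fun c => ENNReal.ofReal (M.bestLookahead (M.iterValue m) c) from
      funext fun c => M.bellman_eq hreg hmean ih (M.iterValue_le hmean m) c]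
    exact (M.measurable_bestLookahead ih).ennreal_ofReal

lemma Model.measurable_limitValue (M : Model n k) (hreg : ∀ i, (M.dist i).Regular)
    (hmean : ∀ i, (M.dist i).FiniteMean) : Measurable M.limitValue :=
  Measurable.iSup fun m => M.measurable_iterValue hreg hmean m

lemma Model.limitValue_le (M : Model n k) (hmean : ∀ i, (M.dist i).FiniteMean) (c : State) :
    M.limitValue c ≤ ENNReal.ofReal M.valueBound :=
  iSup_le fun m => M.iterValue_le hmean m c

lemma Model.lookahead_iSup (M : Model n k) {h : ℕ → State → ℝ≥0∞} (hh : ∀ m, Measurable (h m))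
    (hmono : Monotone h) (a : Mechanism n k) (c : State) :
    M.lookahead (fun s => ⨆ m, h m s) a c = ⨆ m, M.lookahead (h m) a c := by
  unfold Model.lookahead
  simp only [lintegral_iSup hh hmono, ENNReal.mul_iSup]
  rw [ENNReal.finsetSum_iSup_of_monotone, ENNReal.mul_iSup, ENNReal.add_iSup]
  intro W m m' hm
  dsimp only
  gcongr with s
  exact hmono hm s

/-- Monotone convergence moves the supremum over m out of the lookahead, and the suprema over
mechanisms and over m commute. No contraction argument is needed. -/
lemma Model.bellman_limitValue (M : Model n k) (hreg : ∀ i, (M.dist i).Regular)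
    (hmean : ∀ i, (M.dist i).FiniteMean) : M.bellman M.limitValue = M.limitValue := by
  funext c
  calc M.bellman M.limitValue c = ⨆ a, ⨆ m, M.lookahead (M.iterValue m) a c :=
        iSup_congr fun a =>
          M.lookahead_iSup (M.measurable_iterValue hreg hmean) M.iterValue_monotone a c
    _ = ⨆ m, M.iterValue (m + 1) c := iSup_comm
    _ = M.limitValue c := Monotone.iSup_nat_add (f := fun m => M.iterValue m c)
        (fun _ _ h => M.iterValue_monotone h c) 1

/-! ### Discounted sums -/

/-- Telescoping without subtraction: y T serves as the value still to come after T rounds. -/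
lemma tsum_le_of_add_succ_le {x y : ℕ → ℝ≥0∞} (h : ∀ t, x t + y (t + 1) ≤ y t) :
    ∑' t, x t ≤ y 0 := by
  refine ENNReal.tsum_le_of_sum_range_le fun T => ?_
  have : ∑ t ∈ Finset.range T, x t + y T ≤ y 0 := by
    induction T with
    | zero => simp
    | succ T ih =>
      rw [Finset.sum_range_succ, add_assoc]
      exact (add_le_add_right (h T) _).trans ih
  exact le_self_add.trans this

lemma le_tsum_of_le_add_succ {x y : ℕ → ℝ≥0∞} (h : ∀ t, y t ≤ x t + y (t + 1))
    (hy : Filter.Tendsto y Filter.atTop (nhds 0)) : y 0 ≤ ∑' t, x t := by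
  have h1 : ∀ T, y 0 ≤ ∑' t, x t + y T := fun T => by
    have : y 0 ≤ ∑ t ∈ Finset.range T, x t + y T := by
      induction T with
      | zero => simp
      | succ T ih =>
        rw [Finset.sum_range_succ, add_assoc]
        exact ih.trans (add_le_add_right (h T) _)
    exact this.trans (add_le_add_left (ENNReal.sum_le_tsum _) _)
  have h2 := (tendsto_const_nhds (x := ∑' t, x t)).add hy
  rw [add_zero] at h2
  exact ge_of_tendsto' h2 h1

/-! ### Policies compared with the Bellman fixed point. -/

lemma Model.lintegral_step (M : Model n k) (π : Policy n k) (h : State → ℝ≥0∞) (c : State) :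
    ∫⁻ s, h s ∂M.step π c = ∑ W, M.winProb (π.mech c) W * ∫⁻ s, h s ∂M.trans W c := by
  change ∫⁻ s, h s ∂(∑ W, M.winProb (π.mech c) W • M.trans W c) = _
  rw [lintegral_finsetSum_measure]
  simp only [lintegral_smul_measure, smul_eq_mul]

instance (M : Model n k) (π : Policy n k) : IsMarkovKernel (M.step π) := by
  refine ⟨fun c => ⟨?_⟩⟩
  change (∑ W, M.winProb (π.mech c) W • M.trans W c) Set.univ = 1
  simp [Measure.coe_finsetSum, M.sum_winProb]

instance (M : Model n k) (π : Policy n k) (c : State) (t : ℕ) :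
    IsProbabilityMeasure (M.stateLaw π c t) := by
  induction t with
  | zero => exact Measure.dirac.isProbabilityMeasure
  | succ t ih =>
    refine ⟨?_⟩
    change (M.stateLaw π c t).bind (M.step π) Set.univ = 1
    rw [Measure.bind_apply MeasurableSet.univ (M.step π).aemeasurable]
    simp

lemma Model.discounted_lintegral_lookahead (M : Model n k) (π : Policy n k) (c : State)
    {h : State → ℝ≥0∞} (hh : Measurable h) (t : ℕ) :
    ENNReal.ofReal M.γ ^ t * ∫⁻ s, M.lookahead h (π.mech s) s ∂M.stateLaw π c t =
      ENNReal.ofReal M.γ ^ t * ∫⁻ s, M.reward (π.mech s) s ∂M.stateLaw π c t +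
      ENNReal.ofReal M.γ ^ (t + 1) * ∫⁻ s, h s ∂M.stateLaw π c (t + 1) := by
  have hm : Measurable fun s => ∫⁻ s', h s' ∂M.step π s := hh.lintegral_kernel
  have e : ∫⁻ s, h s ∂M.stateLaw π c (t + 1) =
      ∫⁻ s, (∫⁻ s', h s' ∂M.step π s) ∂M.stateLaw π c t :=
    Measure.lintegral_bind (M.step π).aemeasurable hh.aemeasurable
  rw [e, pow_succ, mul_assoc, ← lintegral_const_mul _ hm, ← mul_add,
    ← lintegral_add_right _ (hm.const_mul _)]
  simp only [Model.lookahead, M.lintegral_step]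

/-- The intermediate lookahead is kept for the converse: an optimal policy must make both
inequalities equalities, so its mechanism attains the Bellman maximum in each state. -/
lemma Model.value_le_limitValue (M : Model n k) (hreg : ∀ i, (M.dist i).Regular)
    (hmean : ∀ i, (M.dist i).FiniteMean) (π : Policy n k) (c : State) :
    M.value π c ≤ M.lookahead M.limitValue (π.mech c) c ∧
      M.lookahead M.limitValue (π.mech c) c ≤ M.limitValue c := by
  have hle : ∀ s, M.lookahead M.limitValue (π.mech s) s ≤ M.limitValue s := fun s => by
    conv_rhs => rw [← M.bellman_limitValue hreg hmean]
    exact le_iSup (fun a => M.lookahead M.limitValue a s) _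
  have hu := M.measurable_limitValue hreg hmean
  refine ⟨?_, hle c⟩
  have hx : ∀ t, ENNReal.ofReal M.γ ^ t * ∫⁻ s, M.reward (π.mech s) s ∂M.stateLaw π c t +
      ENNReal.ofReal M.γ ^ (t + 1) * ∫⁻ s, M.limitValue s ∂M.stateLaw π c (t + 1) ≤
      ENNReal.ofReal M.γ ^ t * ∫⁻ s, M.limitValue s ∂M.stateLaw π c t := fun t => by
    rw [← M.discounted_lintegral_lookahead π c hu t]
    gcongr with s
    exact hle s
  -- The telescoping starts at round 1, so that round 0 enters with its exact lookahead instead of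
  -- the bound `limitValue`.
  have h1 := tsum_le_of_add_succ_le fun t => hx (t + 1)
  have h2 := M.discounted_lintegral_lookahead π c hu 0
  have hd : ∀ f : State → ℝ≥0∞, ∫⁻ s, f s ∂M.stateLaw π c 0 = f c := fun f => by
    change ∫⁻ s, f s ∂Measure.dirac c = f c
    exact lintegral_dirac c f
  rw [hd, hd, pow_zero, one_mul, one_mul] at h2
  rw [Model.value, tsum_eq_zero_add' ENNReal.summable, hd, pow_zero, one_mul, h2]
  gcongr

/-- The telescoping now holds with equality in every round, and the value still to come is at most γ
^ t times `valueBound`, which tends to 0. -/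
lemma Model.limitValue_le_value (M : Model n k) (hreg : ∀ i, (M.dist i).Regular)
    (hmean : ∀ i, (M.dist i).FiniteMean) (π : Policy n k)
    (hπ : ∀ s, M.lookahead M.limitValue (π.mech s) s = M.limitValue s) (c : State) :
    M.limitValue c ≤ M.value π c := by
  have hu := M.measurable_limitValue hreg hmean
  have h1 := le_tsum_of_le_add_succ
    (x := fun t => ENNReal.ofReal M.γ ^ t * ∫⁻ s, M.reward (π.mech s) s ∂M.stateLaw π c t)
    (y := fun t => ENNReal.ofReal M.γ ^ t * ∫⁻ s, M.limitValue s ∂M.stateLaw π c t)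
    (fun t => by
      rw [← M.discounted_lintegral_lookahead π c hu t]
      simp only [hπ]
      exact le_rfl) ?_
  · have hd : ∫⁻ s, M.limitValue s ∂M.stateLaw π c 0 = M.limitValue c := lintegral_dirac c _
    rw [hd, pow_zero, one_mul] at h1
    exact h1
  · have hγ : ENNReal.ofReal M.γ < 1 := by
      rw [← ENNReal.ofReal_one]
      exact (ENNReal.ofReal_lt_ofReal_iff one_pos).2 M.γ_lt_one
    have h2 := ENNReal.Tendsto.mul_const (b := ENNReal.ofReal M.valueBound)
      (ENNReal.tendsto_pow_atTop_nhds_zero_of_lt_one hγ) (Or.inr ENNReal.ofReal_ne_top)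
    rw [zero_mul] at h2
    refine tendsto_of_tendsto_of_tendsto_of_le_of_le tendsto_const_nhds h2
      (fun t => zero_le) fun t => ?_
    dsimp only
    gcongr
    exact lintegral_le_of_le (M.limitValue_le hmean)

/-! ### Optimal policies and the rule. -/

lemma Model.lookahead_limitValue_of_obeys (M : Model n k) (hreg : ∀ i, (M.dist i).Regular)
    (hmean : ∀ i, (M.dist i).FiniteMean) (a : Mechanism n k) (c : State)
    (ha : ∀ v, 0 ≤ v → ∀ W, 0 < a.alloc v W →
      Obeys k (M.score c (M.gain M.limitValue c) v) W) :
    M.lookahead M.limitValue a c = M.limitValue c := by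
  rw [M.lookahead_eq_of_obeys hmean (M.limitValue_le hmean) a c ha,
    ← M.bellman_eq hreg hmean (M.measurable_limitValue hreg hmean) (M.limitValue_le hmean),
    M.bellman_limitValue hreg hmean]

lemma Model.optValue_eq_limitValue (M : Model n k) (hreg : ∀ i, (M.dist i).Regular)
    (hmean : ∀ i, (M.dist i).FiniteMean) : M.optValue = M.limitValue := by
  funext c
  have hd := M.measurable_gain (M.measurable_limitValue hreg hmean)
  refine le_antisymm (iSup_le fun π => ?_) ?_
  · obtain ⟨h1, h2⟩ := M.value_le_limitValue hreg hmean π c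
    exact h1.trans h2
  · refine (M.limitValue_le_value hreg hmean (M.greedyPolicy hreg hd) (fun s => ?_) c).trans
      (le_iSup (fun π => M.value π c) _)
    exact M.lookahead_limitValue_of_obeys hreg hmean _ s fun v _ W hW =>
      M.greedyPolicy_obeys hreg hd (M.gain_empty _) s v W hW

lemma Model.isOptimal_of_prescribed (M : Model n k) (hreg : ∀ i, (M.dist i).Regular)
    (hmean : ∀ i, (M.dist i).FiniteMean) (π : Policy n k)
    (hπ : ∀ c v, 0 ≤ v → ∀ W, 0 < (π.mech c).alloc v W → M.Prescribed c v W) :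
    M.IsOptimal π := by
  intro c
  have he := M.optValue_eq_limitValue hreg hmean
  refine le_antisymm (le_iSup (fun π => M.value π c) π) ?_
  rw [he]
  refine M.limitValue_le_value hreg hmean π (fun s => ?_) c
  refine M.lookahead_limitValue_of_obeys hreg hmean _ s fun v hv W hW => ?_
  rw [← he]
  -- `Prescribed` and `welfare` unfold to `Obeys` and to `score` with continuation values `gain
  -- optValue`.
  exact hπ s v hv W hW

/-- The best score includes that of the empty set and is therefore nonnegative. A nonempty set
attaining it escapes the rule only if it ties with the empty set at 0. -/
lemma Model.prescribed_or_of_realScore_eq (M : Model n k) {c : State} {v : Fin n → ℝ}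
    (hv : ∀ i, (M.dist i).invHazard (v i) ≠ ∞) {W : Finset (Fin n)} (hk : W.card ≤ k)
    (h : M.realScore c (M.gain M.optValue c) v W = M.bestScore c (M.gain M.optValue c) v) :
    M.Prescribed c v W ∨ (M.IsMaximizer c v W ∧ M.welfare c v W = 0) := by
  have hs : ∀ W, M.welfare c v W = (M.realScore c (M.gain M.optValue c) v W : EReal) :=
    fun W => M.score_eq_coe (M.gain M.optValue c) (Or.inr fun i _ => hv i)
  have hle : ∀ W' : Finset (Fin n), W'.card ≤ k → M.welfare c v W' ≤ M.welfare c v W :=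
    fun W' hW' => by
      rw [hs, hs, h, EReal.coe_le_coe_iff]
      exact M.realScore_le_bestScore c _ v hW'
  rcases W.eq_empty_or_nonempty with rfl | hne
  · refine Or.inl (Or.inr ⟨rfl, fun W' _ hW' => (hle W' hW').trans ?_⟩)
    rw [hs, M.realScore_empty c (M.gain_empty _ c), EReal.coe_zero]
  · have hmax : M.IsMaximizer c v W := ⟨hne.card_pos, hk, fun W' _ hW' => hle W' hW'⟩
    have h0 : 0 ≤ M.welfare c v W := by
      rw [hs, h]
      exact EReal.coe_nonneg.2 (M.bestScore_nonneg c (M.gain_empty _ c) v)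
    rcases h0.eq_or_lt with h0 | h0
    · exact Or.inr ⟨hmax, h0.symm⟩
    · exact Or.inl (Or.inl ⟨hmax, h0⟩)

end

end AdAuction

open AdAuction
theorem theorem1 {n k : ℕ} (M : Model n k)
    (hreg : ∀ i, (M.dist i).Regular) (hmean : ∀ i, (M.dist i).FiniteMean) :
    -- the optimal value function is measurable and bounded
    Measurable M.optValue ∧ (∃ B : ℝ, ∀ c, M.optValue c ≤ ENNReal.ofReal B) ∧
    -- some optimal policy deterministically obeys the rule in every state
    (∃ π : Policy n k, M.IsOptimal π ∧
      ∀ c v, 0 ≤ v → ∃ W, M.Prescribed c v W ∧ (π.mech c).alloc v W = 1) ∧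
    -- every policy of truthful mechanisms that obeys the rule is optimal
    (∀ π : Policy n k,
      (∀ c v, 0 ≤ v → ∀ W, 0 < (π.mech c).alloc v W → M.Prescribed c v W) → M.IsOptimal π) ∧
    -- every optimal policy almost surely obeys the rule, up to ties at welfare zero
    (∀ π : Policy n k, M.IsOptimal π → ∀ c, ∀ᵐ v ∂M.valueLaw, ∀ W,
      0 < (π.mech c).alloc v W →
        M.Prescribed c v W ∨ (M.IsMaximizer c v W ∧ M.welfare c v W = 0)) := by
  have he := M.optValue_eq_limitValue hreg hmean
  have hm : Measurable M.optValue := he ▸ M.measurable_limitValue hreg hmean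
  have hb : ∀ c, M.optValue c ≤ ENNReal.ofReal M.valueBound := he ▸ M.limitValue_le hmean
  have hd := M.measurable_gain hm
  refine ⟨hm, ⟨_, hb⟩, ⟨M.greedyPolicy hreg hd, ?_, fun c v _ => ?_⟩,
    M.isOptimal_of_prescribed hreg hmean, fun π hπ c => ?_⟩
  · exact M.isOptimal_of_prescribed hreg hmean _ fun c v _ W hW =>
      M.greedyPolicy_obeys hreg hd (M.gain_empty _) c v W hW
  · obtain ⟨W, h1, h2⟩ := M.greedyPolicy_alloc hreg hd (M.gain_empty _) c v
    exact ⟨W, h1, by rw [h2, if_pos rfl]⟩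
  · obtain ⟨h1, h2⟩ := M.value_le_limitValue hreg hmean π c
    rw [hπ c, ← he] at h1
    rw [← he] at h2
    -- Optimality squeezes the lookahead of the chosen mechanism against the fixed point, so this
    -- mechanism attains the one-round maximum. Both sides are nonnegative reals under
    -- `ENNReal.ofReal`, which can thus be cancelled.
    have h3 : M.lookahead M.optValue (π.mech c) c = M.bellman M.optValue c := by
      rw [le_antisymm h2 h1, he, M.bellman_limitValue hreg hmean]
    obtain ⟨h4, h5⟩ := M.lookahead_eq hmean hb (π.mech c) c
    have h6 := M.objective_le hmean (π.mech c) c (M.gain M.optValue c)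
    rw [M.bellman_eq hreg hmean hm hb, h5, Model.bestLookahead,
      ENNReal.ofReal_eq_ofReal_iff h4 (by linarith)] at h3
    filter_upwards [M.realScore_eq_of_objective_eq hmean (π.mech c) c _ (by linarith),
      M.ae_nonneg, M.ae_invHazard_ne_top] with v hv hv0 hH W hW
    refine M.prescribed_or_of_realScore_eq hH ?_ (hv W hW)
    by_contra hk
    exact hW.ne' ((π.mech c).alloc_card v hv0 W (not_le.1 hk))
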